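/- Let $1/2<q<1$ and let $\mu=(\mu_k)_{k\ge 0}$ be a probability distribution on $\{0,1,2,\dots\}$ with $\mu(\{0,1\})<1$. Let $\mathcal T$ be the Bienaymé–Galton–Watson tree with offspring distribution $\sum_{k\ge 0}q^k(1-q)\,\delta_k$, and, independently of $\mathcal T$, let i.i.d. numbers of cars with law $\mu$ arrive at its vertices. Each vertex can accommodate one car; each car parks at its arrival vertex if this is free, and otherwise drives towards the root and parks at the first free vertex, leaving the tree if there is none. Let $X_n$ be the number of cars visiting the root when parking is run on $\mathcal T$ cut above height $n$ (keeping the vertices of height at most $n$ and the cars arriving there), and let $X=\lim_n X_n\in\{0,1,2,\dots\}\cup\{\infty\}$ be the non-decreasing limit. The law $\mu$ is called subcritical (for parking on $\mathcal T$) if $\mathbb E[X]<\infty$. A fully parked tree is a finite rooted plane tree $\mathbf t$ with numbers $a_v\ge 0$ of cars arriving at its vertices $v$ such that all its vertices are occupied in the final parking configuration. Let $\mathbb T_n^{(k)}$ be the set of fully parked trees with $n$ vertices and $k$ outgoing cars (cars that leave through the root), and let $$F(x,y)=\sum_{n\ge 1}\sum_{k\ge 0}\ \sum_{\mathbf t\in\mathbb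 T_n^{(k)}}\Big(\prod_{v\in\mathbf t}\mu_{a_v}\Big)x^n y^k\in[0,\infty]\qquad (x,y\ge 0).$$ Then $\mu$ is subcritical if and only if there is a real number $p>0$ with $qp\ne 1$ such that $F\!\left(\frac{q(1-q)}{(1-qp)^2},1\right)<\infty$ and $$\frac{1-qp}{q}\,F\!\left(\frac{q(1-q)}{(1-qp)^2},1\right)+p=1 .$$ -/

import Mathlib

open MeasureTheory ProbabilityTheory
open scoped ENNReal

namespace Parking

/-! ## Finite plane trees decorated with car arrivals -/

/-- A finite plane (rooted, ordered) tree, each vertex of which carries a number of arriving cars: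
`node a ts` has a root on which `a` cars arrive, and `ts` is the ordered list of the subtrees
attached to the children of the root. -/
inductive CarTree : Type
  | node (a : ℕ) (ts : List CarTree) : CarTree

/-- The number of vertices. -/
def CarTree.size : CarTree → ℕ
  | .node _ ts => 1 + (ts.map fun t => t.size).sum

/-- The number of cars that visit the root in the final parking configuration of a finite tree
(cars parked at the root included). Of the cars visiting a vertex one parks there, if there is any,
and all the others drive on towards the root. Hence the cars visiting a vertex are those that
arrive at it and, for each child visited by `m` cars, `(m - 1)_+` further cars (the subtraction of
natural numbers is truncated). -/
def CarTree.visits : CarTree → ℕ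
  | .node a ts => a + (ts.map fun t => t.visits - 1).sum

/-- The flux of outgoing cars, i.e. of the cars that leave the tree through its root. -/
def CarTree.outgoing (t : CarTree) : ℕ := t.visits - 1

/-- All the vertices are occupied in the final parking configuration: each vertex is visited by at
least one car. (The final configuration in the subtree above a vertex is not affected
by the rest of the tree, since cars only drive towards the root.) -/
def CarTree.FullyParked : CarTree → Prop
  | .node a ts => 1 ≤ (CarTree.node a ts).visits ∧ ∀ t ∈ ts, t.FullyParked

/-- The weight `∏ₓ μ(aₓ)`, the product being over the vertices `x` of the tree. -/
noncomputable def CarTree.weight (μ : PMF ℕ) : CarTree → ℝ≥0∞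
  | .node a ts => μ a * (ts.map fun t => t.weight μ).prod

/-- The set of the fully parked trees with `n` vertices and `k` outgoing cars. -/
def fullyParkedTrees (n k : ℕ) : Set CarTree :=
  {t | t.FullyParked ∧ t.size = n ∧ t.outgoing = k}

/-- The bivariate generating function
`F(x, y) = ∑_{n ≥ 1} ∑_{k ≥ 0} ∑_{t} w(t) xⁿ yᵏ`, where `t` runs over the fully parked trees with
`n` vertices and `k` outgoing cars, as a sum of non-negative terms with values in `[0, ∞]`. -/
noncomputable def F (μ : PMF ℕ) (x y : ℝ≥0∞) : ℝ≥0∞ :=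
  ∑' (n : ℕ) (k : ℕ) (t : fullyParkedTrees (n + 1) k), t.1.weight μ * x ^ (n + 1) * y ^ k

/-! ## The random tree and its parking process -/

/-- A realization of the randomness. Potential vertices are finite words of natural numbers; the
root is the empty word `[]` and the `i`-th child of `u` is `i :: u` (`i = 0, 1, …`). To `u` are
attached its number of children `(ω u).1` and the number `(ω u).2` of the cars arriving at it. Only
the values at the vertices of the tree, which are the words all of whose letters are admissible
child indices, matter. -/
abbrev Realization : Type := List ℕ → ℕ × ℕ

/-- The law of the Bienaymé–Galton–Watson tree with offspring distribution
`∑_k qᵏ (1 - q) δ_k` together with its i.i.d. car arrivals of law `μ`: all the numbers of children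
and of arriving cars are independent. -/
noncomputable def law (q : unitInterval) (μ : PMF ℕ) : Measure Realization :=
  Measure.infinitePi fun _ : List ℕ => (geometricMeasure (unitInterval.symm q)).prod μ.toMeasure

instance (q : unitInterval) (μ : PMF ℕ) : IsProbabilityMeasure (law q μ) := by
  unfold law; infer_instance

/-- The subtree above the vertex `u`, cut above height `n` over `u` (the vertices at height at most
`n` are kept), with its car arrivals. -/
def cut (ω : Realization) : ℕ → List ℕ → CarTree
  | 0, u => .node (ω u).2 []
  | n + 1, u => .node (ω u).2 ((List.range (ω u).1).map fun i => cut ω n (i :: u))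

/-- `X_n`: the number of cars visiting the root when the cars arriving at height at most `n` are
parked on the tree cut above height `n`. -/
def rootVisitsUpTo (ω : Realization) (n : ℕ) : ℕ := (cut ω n []).visits

/-- `X`: the number of cars visiting the root of the (possibly infinite) tree, parking the cars
layer by layer. This is the limit in `[0, ∞]` of the non-decreasing sequence `X_n`. -/
noncomputable def rootVisits (ω : Realization) : ℝ≥0∞ := ⨆ n, (rootVisitsUpTo ω n : ℝ≥0∞)

/-- The law `μ` of the car arrivals is subcritical: `𝔼[X] < ∞`. -/
def Subcritical (q : unitInterval) (μ : PMF ℕ) : Prop := ∫⁻ ω, rootVisits ω ∂(law q μ) < ∞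

/-! The sequence `X_n` is non-decreasing and converges to `X`. -/

theorem cut_visits_le_succ (ω : Realization) (n : ℕ) (u : List ℕ) :
    (cut ω n u).visits ≤ (cut ω (n + 1) u).visits := by
  induction n generalizing u with
  | zero => simp [cut, CarTree.visits]
  | succ n ih =>
    rw [cut, cut, CarTree.visits, CarTree.visits, List.map_map, List.map_map]
    refine Nat.add_le_add_left (List.sum_le_sum fun i _ => ?_) _
    exact Nat.sub_le_sub_right (ih (i :: u)) 1

theorem rootVisitsUpTo_mono (ω : Realization) : Monotone (rootVisitsUpTo ω) :=
  monotone_nat_of_le_succ fun n => cut_visits_le_succ ω n []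

theorem tendsto_rootVisits (ω : Realization) :
    Filter.Tendsto (fun n => (rootVisitsUpTo ω n : ℝ≥0∞)) Filter.atTop (nhds (rootVisits ω)) :=
  tendsto_atTop_iSup fun _ _ h => Nat.cast_le.2 (rootVisitsUpTo_mono ω h)

end Parking

/-! Let M(y) be the generating function of μ and write that of X as A(y) = p + yN(y), so that p =
P(X = 0). Since the offspring law is geometric, splitting at the root gives (p + yN)(1 - q(p + N)) =
(1 - q)M. Splitting a fully parked tree at its root gives for G(y) = F(x, y) an equation of the same
shape, (c + yG)(1 - G) = xM, where c is the weight of the excluded configurations whose root is not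
visited. With s = 1 - qp, the substitution G = (q/s)N, c = qp/s, x = q(1 - q)/s² turns one equation
into the other. (Behind it: the occupied cluster of the root is a fully parked tree with vacant
children inserted everywhere; summing these out leaves (s/q)xⁿ for n vertices.) The condition on p
then says p + N(1) = 1, i.e. A has mass one.

If p exists, evaluation at y = 1 forces c = qp/s, so p + yN is a probability law fixed by the
recursion. By monotonicity it dominates every X_n stochastically (`visitSeries_dominated`), and its
mean is finite because q > 1/2 (`exists_mean_bound`); hence E[X] < ∞.

Conversely, if X is almost surely finite, its law is a fixed point (`exists_fixed_point`) with p > 0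
(`pos_of_fixed_point`), and G = (q/s)N solves the tree equation. The series of fully parked trees is
the least solution (`coeff_treeSeries_le`), hence at most G, but a priori with another constant c'.
`eq_of_quadratic` identifies the two: non-negative coefficients force G to reach a point where the
discriminant for c vanishes (`exists_branch_point`); there the discriminant for c' is a square, so c
≤ c', while the constant coefficients give c' ≤ c. -/

namespace Parking

open PowerSeries

/-! ## Power series with coefficients in `[0, ∞]` -/

/-- The sum of the coefficients. -/
noncomputable def total (A : ℝ≥0∞⟦X⟧) : ℝ≥0∞ := ∑' k, coeff k A

/-- The geometric series `∑ₙ Aⁿ`. -/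
noncomputable def geo (A : ℝ≥0∞⟦X⟧) : ℝ≥0∞⟦X⟧ := mk fun k => ∑' n, coeff k (A ^ n)

theorem geo_eq (A : ℝ≥0∞⟦X⟧) : geo A = 1 + A * geo A := by
  ext k
  rw [geo, coeff_mk, tsum_eq_zero_add' ENNReal.summable, map_add, coeff_mul, pow_zero]
  congr 1
  simp only [coeff_mk, pow_succ', coeff_mul]
  rw [Summable.tsum_finsetSum fun _ _ => ENNReal.summable]
  simp only [ENNReal.tsum_mul_left]

theorem coeff_mul_mono {A B A' B' : ℝ≥0∞⟦X⟧} (hA : ∀ k, coeff k A ≤ coeff k A')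
    (hB : ∀ k, coeff k B ≤ coeff k B') (k : ℕ) : coeff k (A * B) ≤ coeff k (A' * B') := by
  rw [coeff_mul, coeff_mul]
  exact Finset.sum_le_sum fun i _ => mul_le_mul' (hA _) (hB _)

/-- `geo A` is the least solution of `1 + A * K ≤ K`. -/
theorem geo_le {A K : ℝ≥0∞⟦X⟧} (h : ∀ k, coeff k (1 + A * K) ≤ coeff k K) (k : ℕ) :
    coeff k (geo A) ≤ coeff k K := by
  -- Finite geometric sums stay below K: each is obtained from the previous one by S ↦ 1 + A * S.
  have key : ∀ n k, coeff k (∑ i ∈ Finset.range n, A ^ i) ≤ coeff k K := by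
    intro n
    induction n with
    | zero => simp
    | succ n ih =>
      intro k
      refine le_trans ?_ (h k)
      rw [geom_sum_succ, add_comm, map_add, map_add]
      gcongr
      exact coeff_mul_mono (fun _ => le_rfl) ih k
  rw [geo, coeff_mk]
  refine ENNReal.tsum_le_of_sum_range_le fun n => ?_
  simpa using key n k

theorem geo_mono {A B : ℝ≥0∞⟦X⟧} (h : ∀ k, coeff k A ≤ coeff k B) (k : ℕ) :
    coeff k (geo A) ≤ coeff k (geo B) := by
  refine geo_le (fun k => ?_) k
  conv_rhs => rw [geo_eq]
  rw [map_add, map_add]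
  gcongr
  exact coeff_mul_mono h (fun _ => le_rfl) k

theorem coeff_le_total (A : ℝ≥0∞⟦X⟧) (k : ℕ) : coeff k A ≤ total A := ENNReal.le_tsum k

theorem total_add (A B : ℝ≥0∞⟦X⟧) : total (A + B) = total A + total B := by
  simp [total, ENNReal.tsum_add]

theorem total_C (a : ℝ≥0∞) : total (C a) = a := by
  rw [total, tsum_eq_single 0 (fun k hk => by simp [coeff_C, hk])]
  simp

theorem total_one : total 1 = 1 := by
  simpa using total_C 1

theorem total_X_mul (A : ℝ≥0∞⟦X⟧) : total (X * A) = total A := by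
  rw [total, tsum_eq_zero_add' ENNReal.summable]
  simp [coeff_succ_X_mul, total]

theorem total_mul (A B : ℝ≥0∞⟦X⟧) : total (A * B) = total A * total B := by
  simp only [total, coeff_mul]
  rw [← ENNReal.tsum_mul_right]
  simp only [← ENNReal.tsum_mul_left]
  rw [← ENNReal.tsum_prod (f := fun i j => coeff i A * coeff j B),
    ← (Finset.HasAntidiagonal.sigmaAntidiagonalEquivProd (A := ℕ)).tsum_eq, ENNReal.tsum_sigma']
  refine tsum_congr fun k => ?_
  rw [tsum_fintype, ← Finset.sum_coe_sort]
  rfl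

theorem total_pow (A : ℝ≥0∞⟦X⟧) (n : ℕ) : total (A ^ n) = total A ^ n := by
  induction n with
  | zero => simp [total_one]
  | succ n ih => rw [pow_succ, pow_succ, total_mul, ih]

theorem total_geo (A : ℝ≥0∞⟦X⟧) : total (geo A) = (1 - total A)⁻¹ := by
  rw [← ENNReal.tsum_geometric]
  simp only [← total_pow]
  rw [total]
  simp only [geo, coeff_mk, total]
  exact ENNReal.tsum_comm

/-! ## Generating series of combinatorial classes -/

/-- The generating series of the elements of `α`, counted according to the size `f` and with
weight `u`. -/
noncomputable def genSeries {α : Type*} (f : α → ℕ) (u : α → ℝ≥0∞) : ℝ≥0∞⟦X⟧ :=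
  mk fun k => ∑' a, if f a = k then u a else 0

theorem genSeries_prod {α β : Type*} (f : α → ℕ) (u : α → ℝ≥0∞) (g : β → ℕ) (v : β → ℝ≥0∞) :
    genSeries (fun p : α × β => f p.1 + g p.2) (fun p => u p.1 * v p.2) =
      genSeries f u * genSeries g v := by
  ext k
  simp only [genSeries, coeff_mk, coeff_mul]
  simp only [← ENNReal.tsum_mul_right]
  simp only [← ENNReal.tsum_mul_left]
  rw [ENNReal.tsum_prod']
  rw [← Summable.tsum_finsetSum fun _ _ => ENNReal.summable]
  refine tsum_congr fun a => ?_
  rw [← Summable.tsum_finsetSum fun _ _ => ENNReal.summable]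
  refine tsum_congr fun b => ?_
  simp only [ite_mul, mul_ite, zero_mul, mul_zero, ← ite_and]
  split_ifs with h
  · rw [Finset.sum_eq_single (f a, g b)]
    · simp
    · rintro ⟨i, j⟩ _ hij
      rw [if_neg]
      rintro ⟨rfl, rfl⟩
      exact hij rfl
    · intro h'
      simp [h] at h'
  · refine (Finset.sum_eq_zero ?_).symm
    rintro ⟨i, j⟩ hij
    rw [if_neg]
    rintro ⟨rfl, rfl⟩
    exact h (by simpa using hij)

theorem total_genSeries {α : Type*} (f : α → ℕ) (u : α → ℝ≥0∞) :
    total (genSeries f u) = ∑' a, u a := by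
  simp only [total, genSeries, coeff_mk]
  rw [ENNReal.tsum_comm]
  exact tsum_congr fun a => by simp

/-- The generating series of the finite sequences of elements of `α`. -/
theorem genSeries_list {α : Type*} (f : α → ℕ) (u : α → ℝ≥0∞) :
    genSeries (fun l : List α => (l.map f).sum) (fun l => (l.map u).prod) =
      geo (genSeries f u) := by
  have key : ∀ n, genSeries (fun l : List α => (l.map f).sum)
      (fun l => if l.length = n then (l.map u).prod else 0) = genSeries f u ^ n := by
    intro n
    induction n with
    | zero =>
      ext k
      simp only [genSeries, coeff_mk, pow_zero, coeff_one]
      rw [tsum_eq_single []]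
      · simp [eq_comm]
      · intro l hl
        simp [hl]
    | succ n ih =>
      rw [pow_succ', ← ih, ← genSeries_prod]
      ext k
      simp only [genSeries, coeff_mk]
      have hinj : Function.Injective fun p : α × List α => p.1 :: p.2 := by
        rintro ⟨a, l⟩ ⟨b, m⟩ h
        simpa using h
      rw [← hinj.tsum_eq]
      · simp [mul_ite]
      · rintro (_ | ⟨a, l⟩) hl
        · simp at hl
        · exact ⟨(a, l), rfl⟩
  ext k
  rw [geo, coeff_mk]
  simp only [← key]
  simp only [genSeries, coeff_mk]
  rw [ENNReal.tsum_comm]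
  refine tsum_congr fun l => ?_
  split_ifs <;> simp

/-! ## The generating series of the fully parked trees -/

/-- The law `μ` as a power series. -/
noncomputable def pmfSeries (μ : PMF ℕ) : ℝ≥0∞⟦X⟧ := mk fun k => μ k

theorem total_pmfSeries (μ : PMF ℕ) : total (pmfSeries μ) = 1 := by
  simp [total, pmfSeries, μ.tsum_coe]

theorem genSeries_id (μ : PMF ℕ) : genSeries (fun a : ℕ => a) μ = pmfSeries μ := by
  ext k
  simp only [genSeries, pmfSeries, coeff_mk]
  rw [tsum_eq_single k (fun b hb => by simp [hb])]
  simp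

/-- A tree is its root label together with the list of the subtrees of the root. -/
def CarTree.equiv : CarTree ≃ ℕ × List CarTree where
  toFun | .node a ts => (a, ts)
  invFun p := .node p.1 p.2
  left_inv | .node _ _ => rfl
  right_inv _ := rfl

/-- Weights of fully parked trees computed from weights `w` of the subtrees of the root. -/
noncomputable def stepWeight (μ : PMF ℕ) (x : ℝ≥0∞) (w : CarTree → ℝ≥0∞) : CarTree → ℝ≥0∞
  | .node a ts => if 1 ≤ (CarTree.node a ts).visits then x * (μ a * (ts.map w).prod) else 0

/-- The generating series, by the flux of outgoing cars, of the trees with weights `w`. -/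
noncomputable def treeSeries (w : CarTree → ℝ≥0∞) : ℝ≥0∞⟦X⟧ := genSeries CarTree.outgoing w

/-- The visits at the root are its arrivals plus the total flux out of an arbitrary sequence of
subtrees. The index k + 1 appears because one visiting car parks; trees with an unvisited root drop
out. -/
theorem coeff_treeSeries_stepWeight (μ : PMF ℕ) (x : ℝ≥0∞) (w : CarTree → ℝ≥0∞) (k : ℕ) :
    coeff k (treeSeries (stepWeight μ x w)) =
      x * coeff (k + 1) (pmfSeries μ * geo (treeSeries w)) := by
  rw [treeSeries, treeSeries, ← genSeries_list, ← genSeries_id, ← genSeries_prod]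
  simp only [genSeries, coeff_mk]
  rw [← CarTree.equiv.symm.tsum_eq, ← ENNReal.tsum_mul_left]
  refine tsum_congr fun ⟨a, ts⟩ => ?_
  have h : (CarTree.node a ts).visits = a + (ts.map CarTree.outgoing).sum := by
    rw [CarTree.visits]
    rfl
  simp only [CarTree.equiv, Equiv.coe_fn_symm_mk, stepWeight, CarTree.outgoing]
  simp only [h]
  generalize a + (ts.map CarTree.outgoing).sum = m
  rcases m with _ | m
  · simp
  · simp

/-- The weight of a tree in the generating series of the fully parked trees. -/
noncomputable def parkedWeight (μ : PMF ℕ) (x : ℝ≥0∞) (t : CarTree) : ℝ≥0∞ :=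
  open Classical in if t.FullyParked then t.weight μ * x ^ t.size else 0

theorem prod_map_parkedWeight (μ : PMF ℕ) (x : ℝ≥0∞) (ts : List CarTree)
    (h : ∀ t ∈ ts, t.FullyParked) :
    (ts.map (parkedWeight μ x)).prod =
      (ts.map fun t => t.weight μ).prod * x ^ (ts.map fun t => t.size).sum := by
  induction ts with
  | nil => simp
  | cons t ts ih =>
    simp only [List.map_cons, List.prod_cons, List.sum_cons, pow_add]
    rw [ih fun s hs => h s (List.mem_cons_of_mem _ hs), parkedWeight,
      if_pos (h t List.mem_cons_self)]
    ring

theorem stepWeight_parkedWeight (μ : PMF ℕ) (x : ℝ≥0∞) :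
    stepWeight μ x (parkedWeight μ x) = parkedWeight μ x := by
  funext t
  obtain ⟨a, ts⟩ := t
  rw [stepWeight]
  by_cases h : 1 ≤ (CarTree.node a ts).visits
  · rw [if_pos h]
    by_cases h' : ∀ t ∈ ts, t.FullyParked
    · rw [prod_map_parkedWeight μ x ts h', parkedWeight, if_pos, CarTree.weight, CarTree.size]
      · ring
      · rw [CarTree.FullyParked]
        exact ⟨h, h'⟩
    · rw [parkedWeight, if_neg]
      · push Not at h'
        obtain ⟨t, ht, ht'⟩ := h'
        rw [List.prod_eq_zero, mul_zero, mul_zero]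
        exact List.mem_map.2 ⟨t, ht, by rw [parkedWeight, if_neg ht']⟩
      · rw [CarTree.FullyParked]
        exact fun h'' => h' h''.2
  · rw [if_neg h, parkedWeight, if_neg]
    rw [CarTree.FullyParked]
    exact fun h' => h h'.1

/-- The recursion for the weights only looks at strictly smaller trees, so the iterates from 0
become exact tree by tree. This is what makes the tree series a least solution. -/
theorem iterate_stepWeight (μ : PMF ℕ) (x : ℝ≥0∞) (n : ℕ) (t : CarTree) (h : t.size ≤ n) :
    (stepWeight μ x)^[n] 0 t = parkedWeight μ x t := by
  induction n generalizing t with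
  | zero =>
    obtain ⟨a, ts⟩ := t
    rw [CarTree.size] at h
    omega
  | succ n ih =>
    obtain ⟨a, ts⟩ := t
    rw [CarTree.size] at h
    rw [Function.iterate_succ_apply', ← stepWeight_parkedWeight, stepWeight, stepWeight]
    congr 4
    refine List.map_congr_left fun t ht => ih t ?_
    have := List.single_le_sum (l := ts.map fun t => t.size) (by simp) _
      (List.mem_map_of_mem ht)
    omega

/-- The generating series of the fully parked trees is the least solution of its functional
equation. -/
theorem coeff_treeSeries_le {μ : PMF ℕ} {x : ℝ≥0∞} {G : ℝ≥0∞⟦X⟧}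
    (hG : ∀ k, x * coeff (k + 1) (pmfSeries μ * geo G) ≤ coeff k G) (k : ℕ) :
    coeff k (treeSeries (parkedWeight μ x)) ≤ coeff k G := by
  have key : ∀ n k, coeff k (treeSeries ((stepWeight μ x)^[n] 0)) ≤ coeff k G := by
    intro n
    induction n with
    | zero => simp [treeSeries, genSeries]
    | succ n ih =>
      intro k
      rw [Function.iterate_succ_apply', coeff_treeSeries_stepWeight]
      refine le_trans ?_ (hG k)
      gcongr
      exact coeff_mul_mono (fun _ => le_rfl) (geo_mono ih) _
  rw [treeSeries, genSeries, coeff_mk, ENNReal.tsum_eq_iSup_sum]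
  refine iSup_le fun s => le_trans ?_ (key (s.sup CarTree.size) k)
  rw [treeSeries, genSeries, coeff_mk]
  refine le_trans (le_of_eq ?_) (ENNReal.sum_le_tsum s)
  refine Finset.sum_congr rfl fun t ht => ?_
  -- Among finitely many trees, the maximal size is a number of iterations that serves all of them.
  rw [iterate_stepWeight μ x _ t (Finset.le_sup ht)]

/-- The added constant is the coefficient of index 0 on the right: all subtrees of the root are
fully parked, but no car visits the root. -/
theorem treeSeries_functional_equation (μ : PMF ℕ) (x : ℝ≥0∞) :
    X * treeSeries (parkedWeight μ x) +
        C (x * (μ 0 * coeff 0 (geo (treeSeries (parkedWeight μ x))))) =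
      C x * (pmfSeries μ * geo (treeSeries (parkedWeight μ x))) := by
  ext k
  rcases k with _ | k
  · simp [coeff_mul, pmfSeries]
  · rw [map_add, coeff_succ_X_mul, coeff_C_mul, ← coeff_treeSeries_stepWeight,
      stepWeight_parkedWeight, coeff_C, if_neg (by omega), add_zero]

theorem F_one_eq_total (μ : PMF ℕ) (x : ℝ≥0∞) :
    F μ x 1 = total (treeSeries (parkedWeight μ x)) := by
  rw [F, treeSeries, total_genSeries]
  simp only [one_pow, mul_one]
  have hsub : ∀ n k, ∑' t : fullyParkedTrees (n + 1) k, t.1.weight μ * x ^ (n + 1) =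
      ∑' t, (fullyParkedTrees (n + 1) k).indicator (fun t => t.weight μ * x ^ (n + 1)) t :=
    fun n k => tsum_subtype (fullyParkedTrees (n + 1) k) fun t => t.weight μ * x ^ (n + 1)
  simp only [hsub]
  have hswap : ∀ f : ℕ → ℕ → CarTree → ℝ≥0∞, ∑' (n) (k) (t), f n k t = ∑' (t) (n) (k), f n k t :=
    fun f => by
      conv_rhs => rw [ENNReal.tsum_comm]
      exact tsum_congr fun n => ENNReal.tsum_comm
  rw [hswap]
  refine tsum_congr fun t => ?_
  obtain ⟨m, hm⟩ : ∃ m, t.size = m + 1 := by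
    obtain ⟨a, ts⟩ := t
    exact ⟨_, by rw [CarTree.size, add_comm]⟩
  rw [tsum_eq_single m, tsum_eq_single t.outgoing]
  · by_cases h : t.FullyParked <;> simp [Set.indicator, fullyParkedTrees, parkedWeight, h, hm]
  · intro k hk
    simp [Set.indicator, fullyParkedTrees, hk.symm]
  · intro n hn
    refine ENNReal.tsum_eq_zero.2 fun k => ?_
    rw [Set.indicator_of_notMem]
    rintro ⟨_, h, _⟩
    omega

/-! ## Evaluation of real power series -/

/-- The power series `A` converges absolutely at `r`. -/
def AbsConv (A : ℝ⟦X⟧) (r : ℝ) : Prop := Summable fun k => ‖coeff k A * r ^ k‖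

/-- The value of the power series `A` at `r`. -/
noncomputable def ev (A : ℝ⟦X⟧) (r : ℝ) : ℝ := ∑' k, coeff k A * r ^ k

theorem coeff_mul_mul_pow (A B : ℝ⟦X⟧) (r : ℝ) (k : ℕ) :
    coeff k (A * B) * r ^ k =
      ∑ p ∈ Finset.HasAntidiagonal.antidiagonal k, (coeff p.1 A * r ^ p.1) * (coeff p.2 B * r ^ p.2) := by
  rw [coeff_mul, Finset.sum_mul]
  refine Finset.sum_congr rfl fun p hp => ?_
  rw [← Finset.HasAntidiagonal.mem_antidiagonal.1 hp]
  ring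

theorem AbsConv.mul {A B : ℝ⟦X⟧} {r : ℝ} (hA : AbsConv A r) (hB : AbsConv B r) :
    AbsConv (A * B) r := by
  simpa only [AbsConv, coeff_mul_mul_pow] using
    summable_norm_sum_mul_antidiagonal_of_summable_norm hA hB

theorem ev_mul {A B : ℝ⟦X⟧} {r : ℝ} (hA : AbsConv A r) (hB : AbsConv B r) :
    ev (A * B) r = ev A r * ev B r := by
  simpa only [ev, coeff_mul_mul_pow] using
    (tsum_mul_tsum_eq_tsum_sum_antidiagonal_of_summable_norm hA hB).symm

theorem AbsConv.add {A B : ℝ⟦X⟧} {r : ℝ} (hA : AbsConv A r) (hB : AbsConv B r) :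
    AbsConv (A + B) r := by
  simpa only [AbsConv, map_add, add_mul] using (hA.of_norm.add hB.of_norm).norm

theorem ev_add {A B : ℝ⟦X⟧} {r : ℝ} (hA : AbsConv A r) (hB : AbsConv B r) :
    ev (A + B) r = ev A r + ev B r := by
  simpa only [ev, map_add, add_mul] using hA.of_norm.tsum_add hB.of_norm

theorem AbsConv.sub {A B : ℝ⟦X⟧} {r : ℝ} (hA : AbsConv A r) (hB : AbsConv B r) :
    AbsConv (A - B) r := by
  simpa only [AbsConv, map_sub, sub_mul] using (hA.of_norm.sub hB.of_norm).norm

theorem ev_sub {A B : ℝ⟦X⟧} {r : ℝ} (hA : AbsConv A r) (hB : AbsConv B r) :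
    ev (A - B) r = ev A r - ev B r := by
  simpa only [ev, map_sub, sub_mul] using hA.of_norm.tsum_sub hB.of_norm

theorem absConv_C (a r : ℝ) : AbsConv (C a) r :=
  summable_of_ne_finset_zero (s := {0}) fun k hk => by
    simp [coeff_C, Finset.notMem_singleton.1 hk]

theorem absConv_one (r : ℝ) : AbsConv 1 r := by
  simpa using absConv_C 1 r

theorem absConv_X (r : ℝ) : AbsConv X r :=
  summable_of_ne_finset_zero (s := {1}) fun k hk => by
    simp [coeff_X, Finset.notMem_singleton.1 hk]

theorem ev_C (a r : ℝ) : ev (C a) r = a := by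
  rw [ev, tsum_eq_single 0 fun k hk => by simp [coeff_C, hk]]
  simp

theorem ev_one (r : ℝ) : ev 1 r = 1 := by
  simpa using ev_C 1 r

theorem ev_X (r : ℝ) : ev X r = r := by
  rw [ev, tsum_eq_single 1 fun k hk => by simp [coeff_X, hk]]
  simp

theorem ev_zero (A : ℝ⟦X⟧) : ev A 0 = coeff 0 A := by
  rw [ev, tsum_eq_single 0 fun k hk => by simp [hk]]
  simp

theorem AbsConv.of_le {A : ℝ⟦X⟧} {r s : ℝ} (h : AbsConv A s) (hr : 0 ≤ r) (hrs : r ≤ s) :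
    AbsConv A r := by
  refine Summable.of_nonneg_of_le (fun _ => norm_nonneg _) (fun k => ?_) h
  rw [norm_mul, norm_mul, norm_pow, norm_pow, Real.norm_of_nonneg hr,
    Real.norm_of_nonneg (hr.trans hrs)]
  gcongr

theorem AbsConv.of_coeff_le {A B : ℝ⟦X⟧} {r : ℝ} (h : AbsConv B r)
    (hA : ∀ k, 0 ≤ coeff k A) (hAB : ∀ k, coeff k A ≤ coeff k B) : AbsConv A r := by
  refine Summable.of_nonneg_of_le (fun _ => norm_nonneg _) (fun k => ?_) h
  rw [norm_mul, norm_mul, Real.norm_of_nonneg (hA k),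
    Real.norm_of_nonneg ((hA k).trans (hAB k))]
  gcongr
  exact hAB k

theorem continuousOn_ev {A : ℝ⟦X⟧} {s : ℝ} (h : AbsConv A s) :
    ContinuousOn (ev A) (Set.Icc 0 s) := by
  refine continuousOn_tsum (fun k => by fun_prop) h fun k r hr => ?_
  rw [norm_mul, norm_mul, norm_pow, norm_pow, Real.norm_of_nonneg hr.1,
    Real.norm_of_nonneg (hr.1.trans hr.2)]
  gcongr
  exacts [hr.1, hr.2]

theorem ev_nonneg {A : ℝ⟦X⟧} {r : ℝ} (hA : ∀ k, 0 ≤ coeff k A) (hr : 0 ≤ r) : 0 ≤ ev A r :=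
  tsum_nonneg fun k => mul_nonneg (hA k) (pow_nonneg hr k)

theorem ev_le_ev {A : ℝ⟦X⟧} {r s : ℝ} (hA : ∀ k, 0 ≤ coeff k A) (h : AbsConv A s) (hr : 0 ≤ r)
    (hrs : r ≤ s) : ev A r ≤ ev A s := by
  refine (h.of_le hr hrs).of_norm.tsum_le_tsum (fun k => ?_) h.of_norm
  exact mul_le_mul_of_nonneg_left (pow_le_pow_left₀ hr hrs k) (hA k)

/-! ## Quadratic equations for power series with non-negative coefficients -/

/-- For large k the convolution contains twice the products of an early term and a late one, which
linearizes the inequality. Summed over the tail, it makes the tail sums τ contract by R(1 - 2g)/c,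
where g is a partial sum of w; the strict hypothesis is exactly what makes this ratio less than 1.
-/
theorem exists_rate_of_quadratic_le {w : ℕ → ℝ} {c R : ℝ} (hw : ∀ k, 0 ≤ w k) (hc : 0 < c)
    (hR : 0 < R) (hs : Summable w)
    (h : ∀ k, R * ∑ i ∈ Finset.range (k + 1), w i * w (k - i) + c * w (k + 1) ≤ R * w k)
    (hlt : R < c + 2 * R * ∑' k, w k) :
    ∃ (θ B : ℝ) (m : ℕ), 0 < θ ∧ θ < 1 ∧ ∀ k, w (m + k) ≤ B * θ ^ k := by
  obtain ⟨m, hm⟩ : ∃ m, R < c + 2 * R * ∑ k ∈ Finset.range m, w k := by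
    exact (((hs.hasSum.tendsto_sum_nat.const_mul (2 * R)).const_add c).eventually
      (lt_mem_nhds hlt)).exists
  set g := ∑ k ∈ Finset.range m, w k
  set τ : ℕ → ℝ := fun K => ∑' k, w (k + K) with hτ
  have hsK : ∀ K, Summable fun k => w (k + K) := fun K => (summable_nat_add_iff K).2 hs
  have hτ0 : ∀ K, 0 ≤ τ K := fun K => tsum_nonneg fun k => hw _
  have hτs : ∀ K, τ K = w K + τ (K + 1) := fun K => by
    simp only [hτ]
    rw [(hsK K).tsum_eq_zero_add]
    simp only [zero_add, add_assoc, add_comm 1 K]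
  have hanti : Antitone τ := antitone_nat_of_succ_le fun K => by
    rw [hτs K]
    linarith [hw K]
  have hpt : ∀ k, 2 * m ≤ k →
      2 * R * ∑ i ∈ Finset.range m, w i * w (k - i) + c * w (k + 1) ≤ R * w k := by
    intro k hk
    refine le_trans ?_ (h k)
    obtain ⟨l, rfl⟩ := Nat.exists_eq_add_of_le hk
    have h1 : 2 * m + l + 1 = m + ((l + 1) + m) := by ring
    -- The m first and the m last terms of the convolution are disjoint blocks, equal by reflection;
    -- the middle block is dropped.
    have h2 : 2 * ∑ i ∈ Finset.range m, w i * w (2 * m + l - i) ≤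
        ∑ i ∈ Finset.range (2 * m + l + 1), w i * w (2 * m + l - i) := by
      rw [h1, Finset.sum_range_add, Finset.sum_range_add _ (l + 1) m, two_mul]
      have h3 : 0 ≤ ∑ x ∈ Finset.range (l + 1), w (m + x) * w (2 * m + l - (m + x)) :=
        Finset.sum_nonneg fun i _ => mul_nonneg (hw _) (hw _)
      have h4 : ∑ i ∈ Finset.range m, w i * w (2 * m + l - i) =
          ∑ x ∈ Finset.range m, w (m + (l + 1 + x)) * w (2 * m + l - (m + (l + 1 + x))) := by
        rw [← Finset.sum_range_reflect]
        refine Finset.sum_congr rfl fun i hi => ?_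
        have := Finset.mem_range.1 hi
        rw [mul_comm]
        congr 2 <;> omega
      linarith
    rw [mul_assoc, mul_comm 2, mul_assoc, mul_comm _ (2 : ℝ)]
    have := mul_le_mul_of_nonneg_left h2 hR.le
    linarith
  have htail : ∀ K, 2 * m ≤ K → c * τ (K + 1) ≤ R * (1 - 2 * g) * τ K := by
    intro K hK
    have h1 : ∀ k, 2 * R * ∑ i ∈ Finset.range m, w i * w (k + (K - i)) + c * w (k + (K + 1)) ≤
        R * w (k + K) := by
      intro k
      have := hpt (k + K) (by omega)
      refine le_trans (le_of_eq ?_) this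
      congr 2
      refine Finset.sum_congr rfl fun i hi => ?_
      have := Finset.mem_range.1 hi
      congr 2
      omega
    have hsum : Summable fun k => ∑ i ∈ Finset.range m, w i * w (k + (K - i)) :=
      summable_sum fun i _ => (hsK _).mul_left _
    have h2 := ((hsum.mul_left (2 * R)).add ((hsK (K + 1)).mul_left c)).tsum_le_tsum h1
      ((hsK K).mul_left R)
    rw [(hsum.mul_left (2 * R)).tsum_add ((hsK (K + 1)).mul_left c), tsum_mul_left, tsum_mul_left,
      tsum_mul_left, Summable.tsum_finsetSum fun i _ => (hsK _).mul_left _] at h2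
    simp only [tsum_mul_left] at h2
    have h3 : g * τ K ≤ ∑ i ∈ Finset.range m, w i * τ (K - i) := by
      rw [Finset.sum_mul]
      exact Finset.sum_le_sum fun i _ => mul_le_mul_of_nonneg_left (hanti (Nat.sub_le _ _)) (hw i)
    have h4 := mul_le_mul_of_nonneg_left h3 (by positivity : 0 ≤ 2 * R)
    simp only [hτ] at h4 ⊢
    linarith
  -- The contraction ratio may be zero or negative; the maximum with 1/2 keeps θ positive.
  set θ := max (R * (1 - 2 * g) / c) (1 / 2)
  have hθ1 : θ < 1 := max_lt (by rw [div_lt_one hc]; linarith) (by norm_num)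
  have hθ0 : 0 < θ := lt_of_lt_of_le (by norm_num) (le_max_right _ _)
  refine ⟨θ, τ (2 * m), 2 * m, hθ0, hθ1, fun k => ?_⟩
  have hgeom : τ (2 * m + k) ≤ τ (2 * m) * θ ^ k := by
    induction k with
    | zero => simp
    | succ k ih =>
      have h1 := htail (2 * m + k) (by omega)
      have h2 : τ (2 * m + k + 1) ≤ θ * τ (2 * m + k) := by
        have : τ (2 * m + k + 1) ≤ R * (1 - 2 * g) / c * τ (2 * m + k) := by
          rw [div_mul_eq_mul_div, le_div_iff₀ hc]
          linarith
        exact this.trans (mul_le_mul_of_nonneg_right (le_max_left _ _) (hτ0 _))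
      rw [pow_succ, ← add_assoc]
      nlinarith
  refine le_trans ?_ hgeom
  rw [hτs]
  linarith [hτ0 (2 * m + k + 1)]

theorem absConv_iff_summable {A : ℝ⟦X⟧} {r : ℝ} (hA : ∀ k, 0 ≤ coeff k A) (hr : 0 ≤ r) :
    AbsConv A r ↔ Summable fun k => coeff k A * r ^ k := by
  rw [AbsConv]
  exact summable_congr fun k => Real.norm_of_nonneg (mul_nonneg (hA k) (pow_nonneg hr k))

/-- The branch point: a power series `G` with non-negative coefficients that satisfies a quadratic
(in)equation with a genuinely non-linear solution attains the critical value of the quadratic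
equation within its closed disc of convergence. -/
theorem exists_branch_point {G : ℝ⟦X⟧} {c : ℝ} (hG : ∀ k, 0 ≤ coeff k G) (hc : 0 < c)
    (h : ∀ k, coeff k (G * G) + c * coeff (k + 1) G ≤ coeff k G) (h1 : 0 < coeff 1 G)
    (hconv : AbsConv G 1) : ∃ Y, 0 < Y ∧ AbsConv G Y ∧ 2 * Y * ev G Y + c = Y := by
  -- Summing the inequality against r^(k+1) gives r G(r)² ≤ r G(r), so G is at most 1 wherever it
  -- converges.
  have hle : ∀ r, 0 < r → AbsConv G r → ev G r ≤ 1 := by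
    intro r hr hr'
    have hs := hr'.of_norm
    have hs2 := (hr'.mul hr').of_norm
    have hs1 : Summable fun k => coeff (k + 1) G * r ^ (k + 1) :=
      (summable_nat_add_iff (f := fun k => coeff k G * r ^ k) 1).2 hs
    have key : r * ev (G * G) r + c * ∑' k, coeff (k + 1) G * r ^ (k + 1) ≤ r * ev G r := by
      rw [ev, ev, ← tsum_mul_left, ← tsum_mul_left, ← tsum_mul_left,
        ← (hs2.mul_left r).tsum_add (hs1.mul_left c)]
      refine Summable.tsum_le_tsum (fun k => ?_) ((hs2.mul_left r).add (hs1.mul_left c))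
        (hs.mul_left r)
      have := mul_le_mul_of_nonneg_right (h k) (pow_nonneg hr.le (k + 1))
      rw [pow_succ] at this ⊢
      linarith
    rw [ev_mul hr' hr'] at key
    have h0 : 0 ≤ ∑' k, coeff (k + 1) G * r ^ (k + 1) :=
      tsum_nonneg fun k => mul_nonneg (hG _) (pow_nonneg hr.le _)
    by_contra! hlt
    have : 0 < r * (ev G r * (ev G r - 1)) := by
      have : 0 < ev G r - 1 := by linarith
      positivity
    nlinarith [mul_nonneg hc.le h0]
  -- Thanks to the bound by 1, the set of radii of convergence is described by closed conditions on
  -- partial sums. It is bounded because the coefficient of index 1 is positive, so it has a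
  -- greatest element R.
  set S : Set ℝ := {r | 0 ≤ r} ∩ ⋂ K : ℕ, {r | ∑ k ∈ Finset.range K, coeff k G * r ^ k ≤ 1}
  have hmem : ∀ r, 0 < r → (r ∈ S ↔ AbsConv G r) := by
    intro r hr
    rw [absConv_iff_summable hG hr.le]
    constructor
    · rintro ⟨_, hr2⟩
      refine summable_of_sum_range_le (c := 1)
        (fun k => mul_nonneg (hG k) (pow_nonneg hr.le k)) fun K => ?_
      exact Set.mem_iInter.1 hr2 K
    · intro hs
      refine ⟨hr.le, Set.mem_iInter.2 fun K => ?_⟩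
      exact (hs.sum_le_tsum _ fun k _ => mul_nonneg (hG k) (pow_nonneg hr.le k)).trans
        (hle r hr ((absConv_iff_summable hG hr.le).2 hs))
  have hclosed : IsClosed S := by
    refine (isClosed_le continuous_const continuous_id).inter (isClosed_iInter fun K => ?_)
    exact isClosed_le (by fun_prop) continuous_const
  have hbdd : S ⊆ Set.Icc 0 (1 / coeff 1 G) := by
    rintro r ⟨hr1, hr2⟩
    refine ⟨hr1, ?_⟩
    have := Set.mem_iInter.1 hr2 2
    simp only [Finset.sum_range_succ, Finset.range_zero, Finset.sum_empty, Set.mem_ofPred_eq,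
      pow_zero, pow_one, mul_one, zero_add] at this
    rw [le_div_iff₀ h1]
    linarith [hG 0]
  obtain ⟨R, hRS, hRmax⟩ := (isCompact_Icc.of_isClosed_subset hclosed hbdd).exists_isGreatest
    ⟨1, (hmem 1 one_pos).2 hconv⟩
  have hR1 : 1 ≤ R := hRmax ((hmem 1 one_pos).2 hconv)
  have hR : 0 < R := by linarith
  have hRc := (hmem R hR).1 hRS
  -- Otherwise the terms of G at R decay geometrically and G converges beyond R, against maximality.
  have hcrit : 2 * R * ev G R + c ≤ R := by
    by_contra! hlt
    have hquad : ∀ k, R * ∑ i ∈ Finset.range (k + 1), (coeff i G * R ^ i) *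
        (coeff (k - i) G * R ^ (k - i)) + c * (coeff (k + 1) G * R ^ (k + 1)) ≤
        R * (coeff k G * R ^ k) := by
      intro k
      have h2 := mul_le_mul_of_nonneg_right (h k) (pow_nonneg hR.le (k + 1))
      have h3 := coeff_mul_mul_pow G G R k
      rw [Finset.Nat.sum_antidiagonal_eq_sum_range_succ_mk] at h3
      simp only at h3
      rw [← h3]
      rw [pow_succ] at h2 ⊢
      linarith
    obtain ⟨θ, B, m, hθ0, hθ1, hB⟩ := exists_rate_of_quadratic_le
      (w := fun k => coeff k G * R ^ k) (fun k => mul_nonneg (hG k) (pow_nonneg hR.le k)) hc hR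
      hRc.of_norm hquad (by rw [ev] at hlt; linarith)
    -- Any z with 1 < z < 1/θ would do.
    set z := 2 / (1 + θ)
    have hz : 1 < z := by
      rw [lt_div_iff₀ (by linarith)]
      linarith
    have hzθ : θ * z < 1 := by
      rw [← mul_div_assoc, div_lt_one (by linarith)]
      linarith
    have : R * z ∈ S := by
      rw [hmem _ (by positivity), absConv_iff_summable hG (by positivity),
        ← summable_nat_add_iff m]
      refine Summable.of_nonneg_of_le
        (fun k => mul_nonneg (hG _) (by positivity)) (fun k => ?_)
        ((summable_geometric_of_lt_one (by positivity) hzθ).mul_left (B * z ^ m))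
      have := mul_le_mul_of_nonneg_right (hB k) (by positivity : 0 ≤ z ^ (m + k))
      rw [add_comm k m, mul_pow, mul_pow]
      refine le_trans (le_of_eq (by ring)) (this.trans (le_of_eq ?_))
      rw [pow_add]
      ring
    have := hRmax this
    nlinarith
  -- This function equals c > 0 at 0 and is at most 0 at R, so it vanishes in between.
  have hcont : ContinuousOn (fun y => 2 * y * ev G y + c - y) (Set.Icc 0 R) :=
    (((continuousOn_const.mul continuousOn_id).mul (continuousOn_ev hRc)).add
      continuousOn_const).sub continuousOn_id
  obtain ⟨Y, hY, hY0⟩ := intermediate_value_Icc' hR.le hcont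
    (show (0 : ℝ) ∈ Set.Icc _ _ from ⟨by linarith, by simp [hc.le]⟩)
  refine ⟨Y, ?_, hRc.of_le hY.1 hY.2, by linarith⟩
  rcases hY.1.eq_or_lt with h0 | h0
  · rw [← h0] at hY0
    simp only [mul_zero, zero_mul, zero_add, sub_zero] at hY0
    linarith
  · exact h0

/-- Uniqueness of the (nonlinear) solution of `(c + X G) (1 - G) = x M` among the power series
with non-negative coefficients, in presence of the constant `c` as a second unknown. -/
theorem eq_of_quadratic {F G M : ℝ⟦X⟧} {c c' x : ℝ} (hF : ∀ k, 0 ≤ coeff k F)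
    (hFG : ∀ k, coeff k F ≤ coeff k G) (hM : ∀ k, 0 ≤ coeff k M) (hx : 0 < x) (hc : 0 < c)
    (hc' : 0 ≤ c') (hconv : AbsConv G 1) (hM2 : ∃ k, 2 ≤ k ∧ 0 < coeff k M)
    (hGeq : (C c + X * G) * (1 - G) = C x * M) (hFeq : (C c' + X * F) * (1 - F) = C x * M)
    (hM0 : 0 < coeff 0 M) : F = G := by
  have hG : ∀ k, 0 ≤ coeff k G := fun k => (hF k).trans (hFG k)
  have hrec : ∀ k, coeff k (G * G) + c * coeff (k + 1) G + x * coeff (k + 1) M = coeff k G := by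
    intro k
    have h1 : C c + X * G = C x * M + C c * G + X * (G * G) := by
      rw [← hGeq]
      ring
    have h2 := congrArg (coeff (k + 1)) h1
    simp only [map_add, coeff_succ_X_mul, coeff_C_mul, coeff_C, Nat.succ_ne_zero, if_false] at h2
    linarith
  have hle : ∀ k, coeff k (G * G) + c * coeff (k + 1) G ≤ coeff k G := fun k => by
    have := hrec k
    have := mul_nonneg hx.le (hM (k + 1))
    linarith
  have hnn : ∀ k, 0 ≤ coeff k (G * G) := fun k => by
    rw [coeff_mul]
    exact Finset.sum_nonneg fun p _ => mul_nonneg (hG _) (hG _)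
  -- If this coefficient vanished, the recursion would kill all the later ones, and then all
  -- coefficients of M of index at least 2.
  have h1 : 0 < coeff 1 G := by
    refine (hG 1).lt_of_ne fun h0 => ?_
    have hz : ∀ k, coeff (k + 1) G = 0 := by
      intro k
      induction k with
      | zero => exact h0.symm
      | succ k ih =>
        have h2 := hle (k + 1)
        rw [ih] at h2
        have h3 := hnn (k + 1)
        have h4 := hG (k + 1 + 1)
        nlinarith
    obtain ⟨k, hk, hk'⟩ := hM2
    obtain ⟨l, rfl⟩ := Nat.exists_eq_add_of_le' hk
    have h2 := hrec (l + 1)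
    rw [hz, hz] at h2
    have := hnn (l + 1)
    have := mul_pos hx hk'
    linarith
  obtain ⟨Y, hY, hYc, hYe⟩ := exists_branch_point hG hc hle h1 hconv
  have hFc : AbsConv F Y := hYc.of_coeff_le hF hFG
  have hEG := congrArg (fun A => ev A Y) hGeq
  have hEF := congrArg (fun A => ev A Y) hFeq
  rw [ev_mul ((absConv_C _ _).add ((absConv_X _).mul hYc)) ((absConv_one _).sub hYc),
    ev_add (absConv_C _ _) ((absConv_X _).mul hYc), ev_mul (absConv_X _) hYc,
    ev_sub (absConv_one _) hYc, ev_C, ev_X, ev_one] at hEG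
  rw [ev_mul ((absConv_C _ _).add ((absConv_X _).mul hFc)) ((absConv_one _).sub hFc),
    ev_add (absConv_C _ _) ((absConv_X _).mul hFc), ev_mul (absConv_X _) hFc,
    ev_sub (absConv_one _) hFc, ev_C, ev_X, ev_one] at hEF
  -- Completing the square: both (2YG + c - Y)² and (2YF + c' - Y)² equal a discriminant with the
  -- same term -4YxM(Y). The first vanishes at the branch point, the second is non-negative.
  have hcc : (Y + c) ^ 2 ≤ (Y + c') ^ 2 := by
    have e1 : (2 * Y * ev G Y + c - Y) ^ 2 =
        (Y + c) ^ 2 - 4 * Y * ((c + Y * ev G Y) * (1 - ev G Y)) := by ring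
    have e2 : (2 * Y * ev F Y + c' - Y) ^ 2 =
        (Y + c') ^ 2 - 4 * Y * ((c' + Y * ev F Y) * (1 - ev F Y)) := by ring
    have e3 : (2 * Y * ev G Y + c - Y) ^ 2 = 0 := by
      rw [hYe]
      ring
    have e4 := sq_nonneg (2 * Y * ev F Y + c' - Y)
    rw [e2, hEF] at e4
    rw [e1, hEG] at e3
    linarith
  have hcc1 : c ≤ c' := by
    have := abs_le_of_sq_le_sq hcc (by linarith)
    linarith [le_abs_self (Y + c)]
  have hG0 := congrArg (coeff 0) hGeq
  have hF0 := congrArg (coeff 0) hFeq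
  simp at hG0 hF0
  have hFG0 := hFG 0
  simp only [coeff_zero_eq_constantCoeff] at hFG0 hM0
  have hpos := mul_pos hx hM0
  -- At y = 0 the equations read c(1 - G₀) = xM₀ = c'(1 - F₀) with F₀ ≤ G₀ and M₀ > 0, hence c' ≤ c.
  have hcc2 : c = c' := by
    refine le_antisymm hcc1 ?_
    have h5 : 0 < 1 - constantCoeff G := by
      by_contra! h6
      nlinarith
    nlinarith
  subst hcc2
  -- With equal constants the two equations differ by a product; its second factor has constant
  -- coefficient -c ≠ 0.
  have hprod : (G - F) * (X - C c - X * (F + G)) = 0 := by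
    have : (G - F) * (X - C c - X * (F + G)) =
        (C c + X * G) * (1 - G) - (C c + X * F) * (1 - F) := by ring
    rw [this, hGeq, hFeq, sub_self]
  rcases mul_eq_zero.1 hprod with h6 | h6
  · exact (sub_eq_zero.1 h6).symm
  · have := congrArg (coeff 0) h6
    simp at this
    linarith

/-! ## The law of the number of visits -/

/-- The series of the law of a random variable with values in `ℕ`. -/
noncomputable def lawSeries {Ω : Type*} [MeasurableSpace Ω] (P : Measure Ω) (f : Ω → ℕ) :
    ℝ≥0∞⟦X⟧ := mk fun k => P {ω | f ω = k}

theorem lawSeries_add {Ω : Type*} [MeasurableSpace Ω] {P : Measure Ω} {f g : Ω → ℕ}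
    (hf : Measurable f) (hg : Measurable g) (h : IndepFun f g P) :
    lawSeries P (fun ω => f ω + g ω) = lawSeries P f * lawSeries P g := by
  ext k
  rw [coeff_mul]
  simp only [lawSeries, coeff_mk]
  have hset : {ω | f ω + g ω = k} =
      ⋃ p ∈ Finset.HasAntidiagonal.antidiagonal k, f ⁻¹' {p.1} ∩ g ⁻¹' {p.2} := by
    ext ω
    simp only [Set.mem_ofPred_eq, Set.mem_iUnion, Set.mem_inter_iff, Set.mem_preimage,
      Set.mem_singleton_iff, exists_prop, Finset.HasAntidiagonal.mem_antidiagonal]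
    exact ⟨fun h => ⟨(f ω, g ω), h, rfl, rfl⟩, fun ⟨p, hp, h1, h2⟩ => by rw [h1, h2, hp]⟩
  rw [hset, measure_biUnion_finset]
  · refine Finset.sum_congr rfl fun p _ => ?_
    exact h.measure_inter_preimage_eq_mul _ _ (measurableSet_singleton _)
      (measurableSet_singleton _)
  · rintro p - p' - hpp
    refine Set.disjoint_left.2 fun ω h1 h2 => hpp ?_
    exact Prod.ext (h1.1.symm.trans h2.1) (h1.2.symm.trans h2.2)
  · exact fun p _ => (hf (measurableSet_singleton _)).inter (hg (measurableSet_singleton _))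

/-- The series of the law of `X - 1` (truncated subtraction) from that of `X`. -/
noncomputable def predSeries {R : Type*} [Semiring R] (A : R⟦X⟧) : R⟦X⟧ :=
  C (coeff 0 A) + mk fun k => coeff (k + 1) A

theorem lawSeries_pred {Ω : Type*} [MeasurableSpace Ω] {P : Measure Ω} {f : Ω → ℕ}
    (hf : Measurable f) : lawSeries P (fun ω => f ω - 1) = predSeries (lawSeries P f) := by
  ext k
  rw [predSeries, map_add, coeff_mk, coeff_C]
  simp only [lawSeries, coeff_mk]
  rcases k with _ | k
  · rw [if_pos rfl, ← measure_union]
    · congr 1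
      ext ω
      simp only [Set.mem_ofPred_eq, Set.mem_union]
      omega
    · refine Set.disjoint_left.2 fun ω h1 h2 => ?_
      simp only [Set.mem_ofPred_eq] at h1 h2
      omega
    · exact hf (measurableSet_singleton 1)
  · rw [if_neg (by omega), zero_add]
    congr 1
    ext ω
    simp only [Set.mem_ofPred_eq]
    omega

/-! ### Measurability and independence of the visits -/

theorem measurable_comp_of_countable {Ω α : Type*} [MeasurableSpace Ω] [MeasurableSpace α]
    [Countable α] [MeasurableSingletonClass α] {h : Ω → α} (hh : Measurable h) {g : α → Ω → ℕ}
    (hg : ∀ a, Measurable (g a)) : Measurable fun ω => g (h ω) ω := by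
  refine measurable_to_countable' fun k => ?_
  have : (fun ω => g (h ω) ω) ⁻¹' {k} = ⋃ a, h ⁻¹' {a} ∩ g a ⁻¹' {k} := by
    ext ω
    simp
  rw [this]
  exact MeasurableSet.iUnion fun a =>
    (hh (measurableSet_singleton a)).inter (hg a (measurableSet_singleton k))

/-- The `σ`-algebra generated by the labels of the vertices in `S`. -/
abbrev labelAlgebra (S : Set (List ℕ)) : MeasurableSpace Realization :=
  ⨆ v ∈ S, MeasurableSpace.comap (fun ω : Realization => ω v) inferInstance

theorem labelAlgebra_mono {S T : Set (List ℕ)} (h : S ⊆ T) : labelAlgebra S ≤ labelAlgebra T :=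
  biSup_mono fun _ hv => h hv

theorem labelAlgebra_le (S : Set (List ℕ)) : labelAlgebra S ≤ MeasurableSpace.pi :=
  iSup₂_le fun v _ => (measurable_pi_apply v).comap_le

theorem measurable_label {S : Set (List ℕ)} {v : List ℕ} (hv : v ∈ S) :
    Measurable[labelAlgebra S] fun ω : Realization => ω v := by
  rw [measurable_iff_comap_le]
  exact le_biSup (fun v => MeasurableSpace.comap (fun ω : Realization => ω v) inferInstance) hv

theorem indep_labelAlgebra (q : unitInterval) (μ : PMF ℕ) {S T : Set (List ℕ)}
    (h : Disjoint S T) : Indep (labelAlgebra S) (labelAlgebra T) (law q μ) := by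
  refine indep_iSup_of_disjoint (fun v => (measurable_pi_apply v).comap_le) ?_ h
  exact iIndepFun_infinitePi
    (P := fun _ : List ℕ => (geometricMeasure (unitInterval.symm q)).prod μ.toMeasure)
    (X := fun _ x => x) fun _ => measurable_id

/-- The number of cars that reach `u` from its first `N` potential children. -/
def inflow (ω : Realization) (n : ℕ) (u : List ℕ) (N : ℕ) : ℕ :=
  ((List.range N).map fun i => (cut ω n (i :: u)).visits - 1).sum

theorem inflow_succ (ω : Realization) (n : ℕ) (u : List ℕ) (N : ℕ) :
    inflow ω n u (N + 1) = inflow ω n u N + ((cut ω n (N :: u)).visits - 1) := by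
  simp [inflow, List.range_succ]

theorem visits_cut_succ (ω : Realization) (n : ℕ) (u : List ℕ) :
    (cut ω (n + 1) u).visits = (ω u).2 + inflow ω n u (ω u).1 := by
  rw [cut, CarTree.visits, List.map_map]
  rfl

theorem measurable_inflow_of {m : MeasurableSpace Realization} {n : ℕ} {u : List ℕ} {N : ℕ}
    (h : ∀ i < N, Measurable[m] fun ω => (cut ω n (i :: u)).visits) :
    Measurable[m] fun ω => inflow ω n u N := by
  induction N with
  | zero =>
    simp only [inflow, List.range_zero, List.map_nil, List.sum_nil]
    exact measurable_const
  | succ N ih =>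
    simp only [inflow_succ]
    exact (ih fun i hi => h i (by omega)).add
      ((measurable_of_countable fun k : ℕ => k - 1).comp (h N (by omega)))

theorem measurable_visits_cut (n : ℕ) (u : List ℕ) :
    Measurable[labelAlgebra {v | u <:+ v}] fun ω => (cut ω n u).visits := by
  induction n generalizing u with
  | zero =>
    have : (fun ω => (cut ω 0 u).visits) = fun ω : Realization => (ω u).2 := by
      funext ω
      simp [cut, CarTree.visits]
    rw [this]
    exact measurable_snd.comp (measurable_label (S := {v | u <:+ v}) (List.suffix_refl u))
  | succ n ih =>
    simp only [visits_cut_succ]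
    let _ := labelAlgebra {v | u <:+ v}
    refine measurable_comp_of_countable (h := fun ω : Realization => ω u)
      (g := fun p ω => p.2 + inflow ω n u p.1)
      (measurable_label (S := {v | u <:+ v}) (List.suffix_refl u)) fun p => ?_
    refine measurable_const.add (measurable_inflow_of fun i _ => ?_)
    exact (ih (i :: u)).mono
      (labelAlgebra_mono fun v hv => (List.suffix_cons i u).trans hv) le_rfl

theorem measurable_inflow (n : ℕ) (u : List ℕ) (N : ℕ) :
    Measurable[labelAlgebra {v | ∃ i < N, (i :: u) <:+ v}] fun ω => inflow ω n u N :=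
  measurable_inflow_of fun i hi => (measurable_visits_cut n (i :: u)).mono
    (labelAlgebra_mono fun _ hv => ⟨i, hi, hv⟩) le_rfl

theorem indepFun_of_labelAlgebra {q : unitInterval} {μ : PMF ℕ} {S T : Set (List ℕ)}
    (h : Disjoint S T) {α β : Type*} [MeasurableSpace α] [MeasurableSpace β]
    {f : Realization → α} {g : Realization → β}
    (hf : Measurable[labelAlgebra S] f) (hg : Measurable[labelAlgebra T] g) :
    IndepFun f g (law q μ) :=
  indep_of_indep_of_le_left (indep_of_indep_of_le_right (indep_labelAlgebra q μ h) hg.comap_le)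
    hf.comap_le

theorem not_cons_suffix (i : ℕ) (u : List ℕ) : ¬ (i :: u) <:+ u := fun h => by
  simpa using h.length_le

theorem lawSeries_inflow {q : unitInterval} {μ : PMF ℕ} {n : ℕ} {A : ℝ≥0∞⟦X⟧}
    (h : ∀ u, lawSeries (law q μ) (fun ω => (cut ω n u).visits) = A) (u : List ℕ) (N : ℕ) :
    lawSeries (law q μ) (fun ω => inflow ω n u N) = predSeries A ^ N := by
  induction N with
  | zero =>
    ext k
    simp only [inflow, List.range_zero, List.map_nil, List.sum_nil, lawSeries, coeff_mk, pow_zero,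
      coeff_one]
    rcases k with _ | k <;> simp
  | succ N ih =>
    simp only [inflow_succ]
    have hpred : Measurable fun k : ℕ => k - 1 := measurable_of_countable _
    rw [lawSeries_add, ih, lawSeries_pred, h, pow_succ]
    · exact (measurable_visits_cut n (N :: u)).mono (labelAlgebra_le _) le_rfl
    · exact (measurable_inflow n u N).mono (labelAlgebra_le _) le_rfl
    · exact hpred.comp ((measurable_visits_cut n (N :: u)).mono (labelAlgebra_le _) le_rfl)
    · refine indepFun_of_labelAlgebra ?_ (measurable_inflow n u N)
        (hpred.comp (measurable_visits_cut n (N :: u)))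
      -- Two suffixes of the same length of one word coincide, so the subtrees of distinct children
      -- share no vertex.
      refine Set.disjoint_left.2 ?_
      rintro v ⟨i, hi, h1⟩ h2
      have := (List.suffix_of_suffix_length_le h1 h2 (by simp)).eq_of_length (by simp)
      simp only [List.cons.injEq, and_true] at this
      omega

/-! ### The law of the visits as an iterated power series -/

theorem law_label (q : unitInterval) (μ : PMF ℕ) (hq : (q : ℝ) < 1) (u : List ℕ) (N a : ℕ) :
    law q μ ((fun ω => ω u) ⁻¹' {(N, a)}) =
      ENNReal.ofReal (1 - q) * (ENNReal.ofReal q ^ N * μ a) := by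
  rw [law, ← Measure.map_apply (measurable_pi_apply u) (measurableSet_singleton _),
    Measure.infinitePi_map_eval, ← Set.singleton_prod_singleton, Measure.prod_prod,
    geometricMeasure_singleton, PMF.toMeasure_apply_singleton _ _ (measurableSet_singleton _)]
  · rw [unitInterval.coe_symm_eq, sub_sub_cancel, mul_comm (_ ^ N),
      ENNReal.ofReal_mul (by linarith), ENNReal.ofReal_pow q.2.1, mul_assoc]
  · intro h
    have : 1 - (q : ℝ) = 0 := by simpa using congrArg Subtype.val h
    linarith

/-- The law of the number of cars visiting the root of the tree cut above height `n`. -/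
noncomputable def visitSeries (q : unitInterval) (μ : PMF ℕ) : ℕ → ℝ≥0∞⟦X⟧
  | 0 => pmfSeries μ
  | n + 1 => C (ENNReal.ofReal (1 - q)) *
      (pmfSeries μ * geo (C (ENNReal.ofReal q) * predSeries (visitSeries q μ n)))

/-- Given N children, the inflow is a sum of N independent copies of the flux, independent of the
label of u; averaging over the geometric N produces the geometric series. -/
theorem lawSeries_visits (q : unitInterval) (μ : PMF ℕ) (hq : (q : ℝ) < 1) (n : ℕ) (u : List ℕ) :
    lawSeries (law q μ) (fun ω => (cut ω n u).visits) = visitSeries q μ n := by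
  induction n generalizing u with
  | zero =>
    have h0 : (0 : ℝ) ≤ 1 - q := by linarith
    ext k
    simp only [lawSeries, coeff_mk, visitSeries, pmfSeries]
    have : {ω | (cut ω 0 u).visits = k} = ⋃ N, (fun ω : Realization => ω u) ⁻¹' {(N, k)} := by
      ext ω
      simp [cut, CarTree.visits, Prod.ext_iff]
    rw [this, measure_iUnion]
    · simp only [law_label q μ hq]
      rw [ENNReal.tsum_mul_left, ENNReal.tsum_mul_right, ENNReal.tsum_geometric, ← mul_assoc,
        ENNReal.ofReal_sub _ q.2.1, ENNReal.ofReal_one, ENNReal.mul_inv_cancel, one_mul]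
      · rw [← ENNReal.ofReal_one, ← ENNReal.ofReal_sub _ q.2.1]
        simpa using hq
      · simp
    · intro N N' hN
      refine Set.disjoint_left.2 fun ω h1 h2 => hN ?_
      have := h1.symm.trans h2
      exact congrArg Prod.fst this
    · exact fun N => measurable_pi_apply u (measurableSet_singleton _)
  | succ n ih =>
    ext k
    simp only [lawSeries, coeff_mk, visits_cut_succ]
    have hm : ∀ N, Measurable fun ω => inflow ω n u N :=
      fun N => (measurable_inflow n u N).mono (labelAlgebra_le _) le_rfl
    have : {ω : Realization | (ω u).2 + inflow ω n u (ω u).1 = k} =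
        ⋃ N, ⋃ p ∈ Finset.HasAntidiagonal.antidiagonal k,
          (fun ω : Realization => ω u) ⁻¹' {(N, p.1)} ∩ (fun ω => inflow ω n u N) ⁻¹' {p.2} := by
      ext ω
      simp only [Set.mem_ofPred_eq, Set.mem_iUnion, Set.mem_inter_iff, Set.mem_preimage,
        Set.mem_singleton_iff, exists_prop, Finset.HasAntidiagonal.mem_antidiagonal]
      constructor
      · intro h
        exact ⟨(ω u).1, ((ω u).2, inflow ω n u (ω u).1), h, rfl, rfl⟩
      · rintro ⟨N, p, hp, h1, h2⟩
        rw [h1, h2, hp]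
    rw [this, measure_iUnion]
    · have hN : ∀ N, law q μ (⋃ p ∈ Finset.HasAntidiagonal.antidiagonal k,
          (fun ω : Realization => ω u) ⁻¹' {(N, p.1)} ∩
            (fun ω => inflow ω n u N) ⁻¹' {p.2}) =
          ∑ p ∈ Finset.HasAntidiagonal.antidiagonal k, ENNReal.ofReal (1 - q) *
            (μ p.1 * coeff p.2 ((C (ENNReal.ofReal q) * predSeries (visitSeries q μ n)) ^ N)) := by
        intro N
        rw [measure_biUnion_finset]
        · refine Finset.sum_congr rfl fun p _ => ?_
          have hind : IndepFun (fun ω : Realization => ω u) (fun ω => inflow ω n u N)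
              (law q μ) := by
            refine indepFun_of_labelAlgebra (S := {u}) ?_ (measurable_label rfl)
              (measurable_inflow n u N)
            refine Set.disjoint_left.2 ?_
            rintro v rfl ⟨i, _, hi⟩
            exact not_cons_suffix i _ hi
          rw [hind.measure_inter_preimage_eq_mul _ _ (measurableSet_singleton _)
            (measurableSet_singleton _), law_label q μ hq]
          have h2 := congrArg (coeff p.2) (lawSeries_inflow ih u N)
          simp only [lawSeries, coeff_mk] at h2
          rw [mul_pow, ← map_pow, coeff_C_mul, ← h2]
          simp only [Set.preimage, Set.mem_singleton_iff]
          ring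
        · rintro p - p' - hpp
          refine Set.disjoint_left.2 fun ω h1 h2 => hpp ?_
          exact Prod.ext (congrArg Prod.snd (h1.1.symm.trans h2.1)) (h1.2.symm.trans h2.2)
        · exact fun p _ => (measurable_pi_apply u (measurableSet_singleton _)).inter
            (hm N (measurableSet_singleton _))
      simp only [hN]
      rw [Summable.tsum_finsetSum fun _ _ => ENNReal.summable, visitSeries, coeff_C_mul, coeff_mul,
        Finset.mul_sum]
      simp only [ENNReal.tsum_mul_left, pmfSeries, geo, coeff_mk]
    · intro N N' hN
      refine Set.disjoint_left.2 fun ω h1 h2 => hN ?_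
      simp only [Set.mem_iUnion, Set.mem_inter_iff, Set.mem_preimage,
        Set.mem_singleton_iff, exists_prop] at h1 h2
      obtain ⟨p, _, h1, _⟩ := h1
      obtain ⟨p', _, h2, _⟩ := h2
      exact congrArg Prod.fst (h1.symm.trans h2)
    · exact fun N => Finset.measurableSet_biUnion _ fun p _ =>
        (measurable_pi_apply u (measurableSet_singleton _)).inter (hm N (measurableSet_singleton _))

/-! ## From coefficients in `[0, ∞]` to real coefficients -/

/-- The real power series with the coefficients of `A`. -/
noncomputable def realSeries (A : ℝ≥0∞⟦X⟧) : ℝ⟦X⟧ := mk fun k => (coeff k A).toReal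

theorem coeff_realSeries (A : ℝ≥0∞⟦X⟧) (k : ℕ) : coeff k (realSeries A) = (coeff k A).toReal := by
  rw [realSeries, coeff_mk]

theorem coeff_realSeries_nonneg (A : ℝ≥0∞⟦X⟧) (k : ℕ) : 0 ≤ coeff k (realSeries A) := by
  rw [coeff_realSeries]
  exact ENNReal.toReal_nonneg

theorem coeff_ne_top {A : ℝ≥0∞⟦X⟧} (h : total A ≠ ∞) (k : ℕ) : coeff k A ≠ ∞ :=
  ne_top_of_le_ne_top h (coeff_le_total A k)

theorem realSeries_add {A B : ℝ≥0∞⟦X⟧} (hA : total A ≠ ∞) (hB : total B ≠ ∞) :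
    realSeries (A + B) = realSeries A + realSeries B := by
  ext k
  simp only [coeff_realSeries, map_add]
  exact ENNReal.toReal_add (coeff_ne_top hA k) (coeff_ne_top hB k)

theorem realSeries_mul {A B : ℝ≥0∞⟦X⟧} (hA : total A ≠ ∞) (hB : total B ≠ ∞) :
    realSeries (A * B) = realSeries A * realSeries B := by
  ext k
  simp only [coeff_realSeries, coeff_mul]
  rw [ENNReal.toReal_sum fun p _ => ENNReal.mul_ne_top (coeff_ne_top hA _) (coeff_ne_top hB _)]
  simp only [ENNReal.toReal_mul]

theorem realSeries_C (a : ℝ≥0∞) : realSeries (C a) = C a.toReal := by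
  ext k
  rw [coeff_realSeries, coeff_C, coeff_C]
  split_ifs <;> simp

theorem realSeries_one : realSeries 1 = 1 := by
  simpa using realSeries_C 1

theorem realSeries_X_mul (A : ℝ≥0∞⟦X⟧) : realSeries (X * A) = X * realSeries A := by
  ext k
  rcases k with _ | k
  · simp [coeff_realSeries]
  · simp only [coeff_realSeries, coeff_succ_X_mul]

theorem absConv_realSeries {A : ℝ≥0∞⟦X⟧} (h : total A ≠ ∞) : AbsConv (realSeries A) 1 := by
  rw [absConv_iff_summable (coeff_realSeries_nonneg A) zero_le_one]
  simpa [coeff_realSeries] using ENNReal.summable_toReal h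

theorem ev_realSeries_one {A : ℝ≥0∞⟦X⟧} (h : total A ≠ ∞) :
    ev (realSeries A) 1 = (total A).toReal := by
  simp only [ev, coeff_realSeries, one_pow, mul_one]
  exact (ENNReal.tsum_toReal_eq fun k => coeff_ne_top h k).symm

theorem total_predSeries (A : ℝ≥0∞⟦X⟧) : total (predSeries A) = total A := by
  rw [predSeries, total_add, total_C]
  simp only [total, coeff_mk]
  exact (tsum_eq_zero_add' (f := fun k => coeff k A) ENNReal.summable).symm

theorem realSeries_predSeries {A : ℝ≥0∞⟦X⟧} (h : total A ≠ ∞) :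
    realSeries (predSeries A) = predSeries (realSeries A) := by
  have h2 : total (mk fun k => coeff (k + 1) A) ≠ ∞ := by
    refine ne_top_of_le_ne_top h ?_
    simp only [total, coeff_mk]
    exact ENNReal.tsum_comp_le_tsum_of_injective (Nat.succ_injective) fun k => coeff k A
  rw [predSeries, realSeries_add (by rw [total_C]; exact coeff_ne_top h 0) h2, realSeries_C,
    predSeries, coeff_realSeries]
  congr 1
  ext k
  simp only [coeff_realSeries, coeff_mk]

theorem total_geo_ne_top {A : ℝ≥0∞⟦X⟧} (h : total A < 1) : total (geo A) ≠ ∞ := by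
  rw [total_geo]
  exact ENNReal.inv_ne_top.2 (tsub_pos_of_lt h).ne'

/-- Total mass below 1 keeps every coefficient of `geo A` finite; an infinite one would be sent to 0
by `toReal`. -/
theorem realSeries_geo {A : ℝ≥0∞⟦X⟧} (h : total A < 1) :
    realSeries (geo A) * (1 - realSeries A) = 1 := by
  have h1 : total A ≠ ∞ := h.ne_top
  have h2 := total_geo_ne_top h
  have h3 := congrArg realSeries (geo_eq A)
  rw [realSeries_add (by simp [total_one]) (by rw [total_mul]; exact ENNReal.mul_ne_top h1 h2),
    realSeries_mul h1 h2, realSeries_one] at h3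
  linear_combination h3

/-! ## Recursion for the law of the number of visits -/

theorem total_visitSeries (q : unitInterval) (μ : PMF ℕ) (hq : (q : ℝ) < 1) (n : ℕ) :
    total (visitSeries q μ n) = 1 := by
  induction n with
  | zero => exact total_pmfSeries μ
  | succ n ih =>
    rw [visitSeries, total_mul, total_mul, total_geo, total_mul, total_predSeries, total_C,
      total_C, ih, total_pmfSeries, mul_one, one_mul, ENNReal.ofReal_sub _ q.2.1,
      ENNReal.ofReal_one]
    refine ENNReal.mul_inv_cancel ?_ (by simp)
    exact (tsub_pos_of_lt (by simpa using hq)).ne'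

/-- Here K is 1/(1 - q·pred V_n). Its non-negativity is recorded because the domination argument
rests on it. -/
theorem exists_resolvent_visitSeries (q : unitInterval) (μ : PMF ℕ) (hq : (q : ℝ) < 1) (n : ℕ) :
    ∃ K : ℝ⟦X⟧, (∀ k, 0 ≤ coeff k K) ∧
      K * (1 - C (q : ℝ) * predSeries (realSeries (visitSeries q μ n))) = 1 ∧
      realSeries (visitSeries q μ (n + 1)) =
        C (1 - q : ℝ) * (realSeries (pmfSeries μ) * K) := by
  have h0 : (0 : ℝ) ≤ 1 - q := by linarith
  have hV := total_visitSeries q μ hq n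
  have hV' : total (predSeries (visitSeries q μ n)) ≠ ∞ := by
    rw [total_predSeries, hV]
    simp
  have hlt : total (C (ENNReal.ofReal q) * predSeries (visitSeries q μ n)) < 1 := by
    rw [total_mul, total_C, total_predSeries, hV, mul_one]
    simpa using hq
  refine ⟨_, coeff_realSeries_nonneg (geo (C (ENNReal.ofReal q) *
    predSeries (visitSeries q μ n))), ?_, ?_⟩
  · have := realSeries_geo hlt
    rw [realSeries_mul (by simp [total_C]) hV', realSeries_C, ENNReal.toReal_ofReal q.2.1,
      realSeries_predSeries (by simp [hV])] at this
    exact this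
  · have hK := total_geo_ne_top hlt
    rw [visitSeries, realSeries_mul (by simp [total_C]), realSeries_mul, realSeries_C,
      ENNReal.toReal_ofReal h0]
    · simp [total_pmfSeries]
    · exact hK
    · rw [total_mul, total_pmfSeries, one_mul]
      exact hK

/-! ## Real form of the functional equation for fully parked trees -/

theorem treeSeries_quadratic (μ : PMF ℕ) {x : ℝ} (hx : 0 ≤ x)
    (h : total (treeSeries (parkedWeight μ (ENNReal.ofReal x))) < 1) :
    ∃ (c : ℝ) (K : ℝ⟦X⟧), 0 ≤ c ∧ (∀ k, 0 ≤ coeff k K) ∧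
      K * (1 - realSeries (treeSeries (parkedWeight μ (ENNReal.ofReal x)))) = 1 ∧
      (C c + X * realSeries (treeSeries (parkedWeight μ (ENNReal.ofReal x)))) *
        (1 - realSeries (treeSeries (parkedWeight μ (ENNReal.ofReal x)))) =
        C x * realSeries (pmfSeries μ) := by
  have hfe := treeSeries_functional_equation μ (ENNReal.ofReal x)
  set A := treeSeries (parkedWeight μ (ENNReal.ofReal x))
  have hA : total A ≠ ∞ := h.ne_top
  have hK := total_geo_ne_top h
  have hinv := realSeries_geo h
  refine ⟨(ENNReal.ofReal x * (μ 0 * coeff 0 (geo A))).toReal, realSeries (geo A),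
    ENNReal.toReal_nonneg, coeff_realSeries_nonneg _, hinv, ?_⟩
  have hM : total (pmfSeries μ) ≠ ∞ := by simp [total_pmfSeries]
  have h1 := congrArg realSeries hfe
  rw [realSeries_add (by rwa [total_X_mul]) ?_, realSeries_X_mul, realSeries_C,
    realSeries_mul (by simp [total_C]) (by rw [total_mul]; exact ENNReal.mul_ne_top hM hK),
    realSeries_C, realSeries_mul hM hK, ENNReal.toReal_ofReal hx] at h1
  · linear_combination (1 - realSeries A) * h1 + C x * realSeries (pmfSeries μ) * hinv
  · rw [total_C]
    exact ENNReal.mul_ne_top ENNReal.ofReal_ne_top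
      (ENNReal.mul_ne_top (μ.apply_ne_top 0) (coeff_ne_top hK 0))

theorem exists_two_le {μ : PMF ℕ} (hμ : μ 0 + μ 1 < 1) : ∃ k, 2 ≤ k ∧ μ k ≠ 0 := by
  by_contra! h
  have := μ.tsum_coe
  rw [tsum_eq_sum (s := Finset.range 2) fun k hk => h k (by simp at hk; omega),
    Finset.sum_range_succ, Finset.sum_range_one] at this
  exact hμ.ne this

/-- If the generating function of the fully parked trees is finite, then it is less than one. -/
theorem total_treeSeries_lt_one {μ : PMF ℕ} (hμ : μ 0 + μ 1 < 1) {x : ℝ≥0∞} (hx : x ≠ 0)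
    (hx' : x ≠ ∞) (h : total (treeSeries (parkedWeight μ x)) ≠ ∞) :
    total (treeSeries (parkedWeight μ x)) < 1 := by
  have hfe := congrArg total (treeSeries_functional_equation μ x)
  obtain ⟨k, hk, hk0⟩ := exists_two_le hμ
  obtain ⟨l, rfl⟩ := Nat.exists_eq_add_of_le' hk
  have hcoef := coeff_treeSeries_stepWeight μ x (parkedWeight μ x) (l + 1)
  rw [stepWeight_parkedWeight] at hcoef
  set A := treeSeries (parkedWeight μ x)
  -- Some k ≥ 2 has μ k > 0, and x·μ k times this number is bounded by a finite coefficient of A.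
  have hL : coeff 0 (geo A) ≠ ∞ := by
    intro htop
    refine coeff_ne_top h (l + 1) ?_
    rw [hcoef, ← top_le_iff]
    have h1 : μ (l + 2) * coeff 0 (geo A) ≤ coeff (l + 1 + 1) (pmfSeries μ * geo A) := by
      rw [coeff_mul]
      refine le_trans (le_of_eq ?_) (Finset.single_le_sum (f := fun p : ℕ × ℕ =>
        coeff p.1 (pmfSeries μ) * coeff p.2 (geo A)) (fun _ _ => zero_le)
        (show (l + 2, 0) ∈ _ by simp))
      simp only [pmfSeries, coeff_mk]
    rw [htop, ENNReal.mul_top hk0, top_le_iff] at h1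
    rw [h1, ENNReal.mul_top hx]
  rw [total_add, total_X_mul, total_C, total_mul, total_mul, total_C, total_pmfSeries, one_mul,
    total_geo] at hfe
  -- With total mass at least 1 the geometric series sums to ∞, while the other side of the
  -- functional equation is finite.
  by_contra! hge
  rw [tsub_eq_zero_of_le hge, ENNReal.inv_zero, ENNReal.mul_top hx] at hfe
  exact ENNReal.add_ne_top.2 ⟨h, ENNReal.mul_ne_top hx' (ENNReal.mul_ne_top (μ.apply_ne_top 0) hL)⟩
    hfe

/-! ## Stochastic domination -/

/-- The partial sums of the coefficients of a power series. -/
theorem coeff_mul_mk_one (A : ℝ⟦X⟧) (k : ℕ) :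
    coeff k (A * mk 1) = ∑ j ∈ Finset.range (k + 1), coeff j A := by
  rw [coeff_mul, Finset.Nat.sum_antidiagonal_eq_sum_range_succ_mk]
  simp

theorem coeff_mul_nonneg {A B : ℝ⟦X⟧} (hA : ∀ k, 0 ≤ coeff k A) (hB : ∀ k, 0 ≤ coeff k B)
    (k : ℕ) : 0 ≤ coeff k (A * B) := by
  rw [coeff_mul]
  exact Finset.sum_nonneg fun p _ => mul_nonneg (hA _) (hB _)

/-- For distribution functions: (X - 1)₊ ≤ k if and only if X ≤ k + 1. -/
theorem coeff_predSeries_mul_mk_one (A : ℝ⟦X⟧) (k : ℕ) :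
    coeff k (predSeries A * mk 1) = coeff (k + 1) (A * mk 1) := by
  rw [coeff_mul_mk_one, coeff_mul_mk_one, Finset.sum_range_succ', Finset.sum_range_succ']
  simp only [predSeries, map_add, coeff_mk, coeff_C]
  rw [Finset.sum_range_succ' _ k]
  simp
  ring

/-- Monotonicity of the recursion with respect to the order of distribution functions. -/
theorem coeff_sub_mul_mk_one_nonneg {q : ℝ} (hq : 0 ≤ q) (hq' : q ≤ 1) {M K K' A A' : ℝ⟦X⟧}
    (hM : ∀ k, 0 ≤ coeff k M) (hK : ∀ k, 0 ≤ coeff k K) (hK' : ∀ k, 0 ≤ coeff k K')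
    (h : K * (1 - C q * A) = 1) (h' : K' * (1 - C q * A') = 1)
    (hA : ∀ k, 0 ≤ coeff k ((A - A') * mk 1)) (k : ℕ) :
    0 ≤ coeff k ((C (1 - q) * (M * K) - C (1 - q) * (M * K')) * mk 1) := by
  -- The resolvent identity K - K' = q K K' (A - A') exhibits the difference as a product of
  -- non-negative series.
  have e : (C (1 - q) * (M * K) - C (1 - q) * (M * K')) * mk 1 =
      C ((1 - q) * q) * (M * (K * (K' * ((A - A') * mk 1)))) := by
    rw [map_mul]
    linear_combination C (1 - q) * M * mk 1 * (K' * h - K * h')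
  rw [e, coeff_C_mul]
  exact mul_nonneg (mul_nonneg (by linarith) hq)
    (coeff_mul_nonneg hM (coeff_mul_nonneg hK (coeff_mul_nonneg hK' hA)) k)

/-- A fixed point of the recursion dominates the laws of the numbers of visits. -/
theorem visitSeries_dominated {q : unitInterval} {μ : PMF ℕ} (hq : (q : ℝ) < 1) {A K : ℝ⟦X⟧}
    (hK : ∀ k, 0 ≤ coeff k K) (hK1 : K * (1 - C (q : ℝ) * predSeries A) = 1)
    (hA : A = C (1 - q : ℝ) * (realSeries (pmfSeries μ) * K))
    (hA1 : ∀ k, coeff k (A * mk 1) ≤ 1) (n k : ℕ) :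
    coeff k (A * mk 1) ≤ coeff k (realSeries (visitSeries q μ n) * mk 1) := by
  have hM := coeff_realSeries_nonneg (pmfSeries μ)
  have hq0 := q.2.1
  rw [← sub_nonneg, ← map_sub, ← sub_mul]
  induction n generalizing k with
  | zero =>
    have h1 : (1 - q : ℝ) ≠ 0 := by linarith
    have h2 : C (1 - q : ℝ) * C (1 - q : ℝ)⁻¹ = (1 : ℝ⟦X⟧) := by
      rw [← map_mul, mul_inv_cancel₀ h1, map_one]
    -- The law μ of X_0 is one step of the recursion from a zero inflow, whose series is 1 and whose
    -- resolvent is 1/(1 - q).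
    have h3 : realSeries (visitSeries q μ 0) =
        C (1 - q : ℝ) * (realSeries (pmfSeries μ) * C (1 - q : ℝ)⁻¹) := by
      rw [visitSeries]
      linear_combination -realSeries (pmfSeries μ) * h2
    rw [h3, hA]
    refine coeff_sub_mul_mk_one_nonneg (A := 1) (A' := predSeries A) hq0 hq.le hM ?_ hK ?_ hK1 ?_ k
    · intro k
      rw [coeff_C]
      split_ifs
      · exact inv_nonneg.2 (by linarith)
      · rfl
    · rw [map_sub, map_one] at h2
      linear_combination h2
    · intro k
      rw [sub_mul, map_sub, coeff_predSeries_mul_mk_one, one_mul, coeff_mk]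
      have := hA1 (k + 1)
      simpa using this
  | succ n ih =>
    obtain ⟨K', hK', hK1', hV⟩ := exists_resolvent_visitSeries q μ hq n
    rw [hV, hA]
    refine coeff_sub_mul_mk_one_nonneg hq0 hq.le hM hK' hK hK1' hK1 (fun k => ?_) k
    have := ih (k + 1)
    rw [sub_mul, map_sub] at this ⊢
    rw [coeff_predSeries_mul_mk_one, coeff_predSeries_mul_mk_one]
    rwa [hA] at this ⊢

/-! ## The mean of a fixed point -/

/-- With a = A(y), the equation and M(y) ≤ 1 give (2q - 1)(1 - a) ≤ q(1 - a)² + O(1 - y). Near y = 1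
half of the left side absorbs the square, since 2q - 1 > 0. So the tail series T = (1 - A)/(1 - y)
stays bounded, and its value at 1 is the mean. -/
theorem exists_mean_bound {q p : ℝ} (hq : 1 / 2 < q) (hp : 0 ≤ p) (hqp : q * p < 1)
    {N M : ℝ⟦X⟧} (hN : ∀ k, 0 ≤ coeff k N) (hM : ∀ k, 0 ≤ coeff k M)
    (hNc : AbsConv N 1) (hMc : AbsConv M 1) (hN1 : p + ev N 1 = 1) (hM1 : ev M 1 = 1)
    (hq' : q < 1)
    (h : (C p + X * N) * (1 - C q * (C p + N)) = C (1 - q) * M) :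
    ∃ B : ℝ, ∀ n, ∑ k ∈ Finset.range n, (1 - coeff k ((C p + X * N) * mk 1)) ≤ B := by
  set A := C p + X * N with hA
  have hAc : AbsConv A 1 := (absConv_C _ _).add ((absConv_X _).mul hNc)
  have hevA : ∀ y, AbsConv N y → ev A y = p + y * ev N y := fun y hy => by
    rw [hA, ev_add (absConv_C _ _) ((absConv_X _).mul hy), ev_mul (absConv_X _) hy, ev_C, ev_X]
  have hA1 : ev A 1 = 1 := by rw [hevA 1 hNc, one_mul, hN1]
  have hA0 : ∀ k, 0 ≤ coeff k A := by
    intro k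
    rcases k with _ | k
    · simp [hA, hp]
    · simp [hA, coeff_succ_X_mul, hN]
  set T : ℝ⟦X⟧ := (1 - A) * mk 1 with hT
  have hcoefT : ∀ k, coeff k T = 1 - coeff k (A * mk 1) := fun k => by
    rw [hT, sub_mul, map_sub, one_mul, coeff_mk, Pi.one_apply]
  have hT0 : ∀ k, 0 ≤ coeff k T := fun k => by
    rw [hcoefT, sub_nonneg, coeff_mul_mk_one, ← hA1, ev]
    have := hAc.of_norm
    simp only [one_pow, mul_one] at this ⊢
    exact this.sum_le_tsum _ fun k _ => hA0 k
  have hgeom : (mk 1 : ℝ⟦X⟧) * (1 - X) = 1 := mk_one_mul_one_sub_eq_one ℝ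
  have hTX : T * (1 - X) = 1 - A := by
    rw [hT]
    linear_combination (1 - A) * hgeom
  have hTc : ∀ y, 0 ≤ y → y < 1 → AbsConv T y := by
    intro y hy hy1
    refine ((absConv_one y).sub (hAc.of_le hy hy1.le)).mul ?_
    rw [absConv_iff_summable (fun k => by simp) hy]
    simpa using summable_geometric_of_lt_one hy hy1
  have hcont : Filter.Tendsto (ev A) (nhdsWithin 1 (Set.Icc 0 1)) (nhds 1) := by
    have := continuousOn_ev hAc 1 ⟨zero_le_one, le_rfl⟩
    rwa [ContinuousWithinAt, hA1] at this
  have hlim : Filter.Tendsto (ev A) (nhdsWithin 1 (Set.Ioo 0 1)) (nhds 1) :=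
    hcont.mono_left (nhdsWithin_mono _ Set.Ioo_subset_Icc_self)
  have hne : (nhdsWithin (1 : ℝ) (Set.Ioo 0 1)).NeBot := right_nhdsWithin_Ioo_neBot one_pos
  set B := 2 * (q * (1 - p)) / (2 * q - 1)
  have hev : ∀ᶠ y in nhdsWithin (1 : ℝ) (Set.Ioo 0 1), ev T y ≤ B := by
    have h1 : 1 - (2 * q - 1) / (2 * q) < 1 := by
      have : 0 < (2 * q - 1) / (2 * q) := div_pos (by linarith) (by linarith)
      linarith
    filter_upwards [hlim.eventually (lt_mem_nhds h1), self_mem_nhdsWithin] with y hy1 hy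
    have hyN : AbsConv N y := hNc.of_le hy.1.le hy.2.le
    have hyM : AbsConv M y := hMc.of_le hy.1.le hy.2.le
    have hyA : AbsConv A y := hAc.of_le hy.1.le hy.2.le
    have hTy := congrArg (fun D => ev D y) hTX
    rw [ev_mul (hTc y hy.1.le hy.2) ((absConv_one _).sub (absConv_X _)),
      ev_sub (absConv_one _) (absConv_X _), ev_sub (absConv_one _) hyA, ev_one, ev_X] at hTy
    have hy0 := congrArg (fun D => ev D y) h
    have hc1 := (absConv_C p y).add hyN
    have hc2 := (absConv_C q y).mul hc1
    rw [ev_mul hyA ((absConv_one _).sub hc2), ev_sub (absConv_one _) hc2,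
      ev_mul (absConv_C _ _) hc1, ev_add (absConv_C _ _) hyN, ev_mul (absConv_C _ _) hyM, ev_C,
      ev_C, ev_C, ev_one] at hy0
    have hMy : ev M y ≤ 1 := hM1 ▸ ev_le_ev hM hMc hy.1.le hy.2.le
    have hAy := hevA y hyN
    have hAy1 : ev A y ≤ 1 := hA1 ▸ ev_le_ev hA0 hAc hy.1.le hy.2.le
    set a := ev A y
    set b := ev N y
    set t := ev T y
    -- Multiplying the equation by y allows N to be eliminated through yN = a - p.
    have e1 : a * (y - q * p * y - q * (a - p)) ≤ (1 - q) * y := by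
      have : a * (y - q * p * y - q * (a - p)) = y * (a * (1 - q * (p + b))) := by
        rw [hAy]
        ring
      rw [this, hy0]
      have := mul_le_mul_of_nonneg_left hMy (mul_nonneg hy.1.le (by linarith : 0 ≤ 1 - q))
      linarith
    have e2 : q * (1 - a) ≤ (2 * q - 1) / 2 := by
      have : (1 - a) < (2 * q - 1) / (2 * q) := by linarith
      rw [lt_div_iff₀ (by linarith)] at this
      linarith
    have e3 := mul_le_mul_of_nonneg_right e2 (sub_nonneg.2 hAy1)
    have e4 : 0 ≤ (1 - a) * ((1 - y) * (1 - q * p)) :=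
      mul_nonneg (by linarith) (mul_nonneg (by linarith [hy.2]) (by linarith))
    have e5 : (2 * q - 1) / 2 * (1 - a) ≤ (1 - y) * (q * (1 - p)) := by nlinarith
    rw [le_div_iff₀ (by linarith)]
    rw [← hTy] at e5
    have hy3 : 0 < 1 - y := by linarith [hy.2]
    have e6 : (1 - y) * (t * (2 * q - 1)) ≤ (1 - y) * (2 * (q * (1 - p))) := by linarith
    exact le_of_mul_le_mul_left e6 hy3
  refine ⟨B, fun n => ?_⟩
  have hpoly : Filter.Tendsto (fun y : ℝ => ∑ k ∈ Finset.range n, coeff k T * y ^ k)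
      (nhdsWithin 1 (Set.Ioo 0 1)) (nhds (∑ k ∈ Finset.range n, coeff k T * 1 ^ k)) := by
    refine Filter.Tendsto.mono_left (Continuous.tendsto ?_ 1) nhdsWithin_le_nhds
    fun_prop
  simp only [one_pow, mul_one, hcoefT] at hpoly
  refine le_of_tendsto hpoly ?_
  filter_upwards [hev, self_mem_nhdsWithin] with y hy hy'
  refine le_trans ?_ hy
  simp only [← hcoefT]
  exact (hTc y hy'.1.le hy'.2).of_norm.sum_le_tsum _
    fun k _ => mul_nonneg (hT0 k) (pow_nonneg hy'.1.le k)

/-- A solution of the fixed point equation charges zero. -/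
theorem pos_of_fixed_point {q p : ℝ} (hq : 1 / 2 < q) (hq' : q < 1) (hp : 0 ≤ p)
    {N M : ℝ⟦X⟧} (hN : ∀ k, 0 ≤ coeff k N) (hM : ∀ k, 0 ≤ coeff k M)
    (hNc : AbsConv N 1) (hMc : AbsConv M 1) (hN1 : p + ev N 1 = 1) (hM1 : ev M 1 = 1)
    (hM2 : ∃ k, 2 ≤ k ∧ 0 < coeff k M)
    (h : (C p + X * N) * (1 - C q * (C p + N)) = C (1 - q) * M) : 0 < p := by
  refine hp.lt_of_ne fun h0 => ?_
  subst h0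
  simp only [map_zero, zero_add] at h hN1
  -- With p = 0, a constant N would make M a multiple of y.
  have hnonconst : ∃ k, 1 ≤ k ∧ 0 < coeff k N := by
    by_contra! hz
    have hNC : N = C (coeff 0 N) := by
      ext k
      rcases k with _ | k
      · simp
      · rw [coeff_C, if_neg (by omega)]
        exact le_antisymm (hz _ (by omega)) (hN _)
    obtain ⟨k, hk, hk'⟩ := hM2
    obtain ⟨l, rfl⟩ := Nat.exists_eq_add_of_le' hk
    have h1 := congrArg (coeff (l + 2)) h
    rw [hNC, ← map_mul, ← map_one (C (R := ℝ)), ← map_sub, mul_assoc, ← map_mul,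
      coeff_succ_X_mul, coeff_C_mul, coeff_C, if_neg (by omega)] at h1
    have := mul_pos (by linarith : 0 < 1 - q) hk'
    linarith
  obtain ⟨k, hk, hk'⟩ := hnonconst
  have hlim : Filter.Tendsto (ev N) (nhdsWithin 1 (Set.Ioo 0 1)) (nhds 1) := by
    have := continuousOn_ev hNc 1 ⟨zero_le_one, le_rfl⟩
    rw [ContinuousWithinAt, hN1] at this
    exact this.mono_left (nhdsWithin_mono _ Set.Ioo_subset_Icc_self)
  have hne : (nhdsWithin (1 : ℝ) (Set.Ioo 0 1)).NeBot := right_nhdsWithin_Ioo_neBot one_pos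
  -- Here q > 1/2 enters: y is chosen close enough to 1 that N(y) > (1 - q)/q.
  have hlt : (1 - q) / q < 1 := by
    rw [div_lt_one (by linarith)]
    linarith
  obtain ⟨y, hy1, hy⟩ := ((hlim.eventually (lt_mem_nhds hlt)).and self_mem_nhdsWithin).exists
  have hyN : AbsConv N y := hNc.of_le hy.1.le hy.2.le
  have hyM : AbsConv M y := hMc.of_le hy.1.le hy.2.le
  have hNy : ev N y < 1 := by
    rw [← hN1]
    refine hyN.of_norm.tsum_lt_tsum (i := k) (fun j => ?_) ?_ hNc.of_norm
    · exact mul_le_mul_of_nonneg_left (pow_le_pow_left₀ hy.1.le hy.2.le j) (hN j)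
    · exact mul_lt_mul_of_pos_left (pow_lt_pow_left₀ hy.2 hy.1.le (by omega)) hk'
  have hMy : ev M y ≤ y := by
    have h0 : coeff 0 M = 0 := by
      have := congrArg (coeff 0) h
      rw [mul_assoc, coeff_zero_X_mul, coeff_C_mul] at this
      have h3 : (1 - q) ≠ 0 := by linarith
      rcases mul_eq_zero.1 this.symm with h4 | h4
      · exact absurd h4 h3
      · exact h4
    rw [ev, hyM.of_norm.tsum_eq_zero_add, h0, zero_mul, zero_add]
    have h1 : ev M 1 = ∑' k, coeff (k + 1) M := by
      rw [ev, hMc.of_norm.tsum_eq_zero_add, h0]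
      simp
    have h2 : Summable fun k => coeff (k + 1) M := by
      simpa using (summable_nat_add_iff (f := fun k => coeff k M * 1 ^ k) 1).2 hMc.of_norm
    calc ∑' k, coeff (k + 1) M * y ^ (k + 1) ≤ ∑' k, coeff (k + 1) M * y := by
          refine Summable.tsum_le_tsum (fun k => ?_)
            ((summable_nat_add_iff (f := fun k => coeff k M * y ^ k) 1).2 hyM.of_norm)
            (h2.mul_right y)
          refine mul_le_mul_of_nonneg_left ?_ (hM _)
          exact pow_le_of_le_one hy.1.le hy.2.le (by omega)
      _ = y := by rw [tsum_mul_right, ← h1, hM1, one_mul]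
  have hy0 := congrArg (fun D => ev D y) h
  rw [ev_mul ((absConv_X _).mul hyN) ((absConv_one _).sub ((absConv_C _ _).mul hyN)),
    ev_mul (absConv_X _) hyN, ev_sub (absConv_one _) ((absConv_C _ _).mul hyN),
    ev_mul (absConv_C _ _) hyN, ev_mul (absConv_C _ _) hyM, ev_C, ev_C, ev_X, ev_one] at hy0
  set g := ev N y
  rw [div_lt_iff₀ (by linarith)] at hy1
  have h5 : y * (g * (1 - q * g)) ≤ y * (1 - q) := by
    have := mul_le_mul_of_nonneg_left hMy (by linarith : 0 ≤ 1 - q)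
    linarith
  have h6 := le_of_mul_le_mul_left h5 hy.1
  -- The inequality g(1 - qg) ≤ 1 - q says that this product of two positive factors is at most 0.
  have h7 : 0 < (1 - g) * (q + q * g - 1) := mul_pos (by linarith) (by linarith)
  linarith

/-! ## The distribution functions of `X_n` and `X` -/

theorem measurable_rootVisitsUpTo (n : ℕ) : Measurable fun ω => rootVisitsUpTo ω n :=
  (measurable_visits_cut n []).mono (labelAlgebra_le _) le_rfl

/-- The distribution function of `X_n`. -/
theorem measureReal_rootVisitsUpTo_le {q : unitInterval} {μ : PMF ℕ} (hq : (q : ℝ) < 1)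
    (n k : ℕ) : (law q μ).real {ω | rootVisitsUpTo ω n ≤ k} =
      coeff k (realSeries (visitSeries q μ n) * mk 1) := by
  rw [coeff_mul_mk_one, ← lawSeries_visits q μ hq n []]
  have hset : {ω | rootVisitsUpTo ω n ≤ k} =
      ⋃ j ∈ Finset.range (k + 1), {ω | (cut ω n []).visits = j} := by
    ext ω
    simp [rootVisitsUpTo]
  rw [hset, measureReal_biUnion_finset]
  · simp only [coeff_realSeries, lawSeries, coeff_mk]
    rfl
  · rintro i - j - hij
    exact Set.disjoint_left.2 fun ω h1 h2 => hij (h1.symm.trans h2)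
  · exact fun j _ => measurable_rootVisitsUpTo n (measurableSet_singleton j)

theorem natCast_eq_tsum (m : ℕ) : (m : ℝ≥0∞) = ∑' k, if k < m then 1 else 0 := by
  rw [tsum_eq_sum (s := Finset.range m) fun k hk => if_neg (by simpa using hk),
    Finset.sum_ite_of_true fun k hk => Finset.mem_range.1 hk]
  simp

theorem lintegral_natCast {Ω : Type*} [MeasurableSpace Ω] (P : Measure Ω) {f : Ω → ℕ}
    (hf : Measurable f) : ∫⁻ ω, (f ω : ℝ≥0∞) ∂P = ∑' k, P {ω | k < f ω} := by
  simp only [natCast_eq_tsum]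
  have hm : ∀ k, MeasurableSet {ω | k < f ω} := fun k => hf measurableSet_Ioi
  rw [lintegral_tsum fun k =>
    (Measurable.ite (hm k) measurable_const measurable_const).aemeasurable]
  refine tsum_congr fun k => ?_
  rw [← lintegral_indicator_one (hm k)]
  exact lintegral_congr fun ω => by simp [Set.indicator]

theorem lintegral_rootVisits (q : unitInterval) (μ : PMF ℕ) :
    ∫⁻ ω, rootVisits ω ∂(law q μ) = ⨆ n, ∫⁻ ω, (rootVisitsUpTo ω n : ℝ≥0∞) ∂(law q μ) := by
  simp only [rootVisits]
  refine lintegral_iSup (fun n => ?_) fun n m h ω => Nat.cast_le.2 (rootVisitsUpTo_mono ω h)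
  exact (measurable_of_countable fun k : ℕ => (k : ℝ≥0∞)).comp (measurable_rootVisitsUpTo n)

theorem law_lt_rootVisitsUpTo {q : unitInterval} {μ : PMF ℕ} (hq : (q : ℝ) < 1) (n k : ℕ) :
    law q μ {ω | k < rootVisitsUpTo ω n} =
      ENNReal.ofReal (1 - coeff k (realSeries (visitSeries q μ n) * mk 1)) := by
  have hm : MeasurableSet {ω | rootVisitsUpTo ω n ≤ k} :=
    measurable_rootVisitsUpTo n measurableSet_Iic
  rw [← measureReal_rootVisitsUpTo_le hq, ← probReal_compl_eq_one_sub hm, ofReal_measureReal]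
  congr 1
  ext ω
  simp

theorem pmf_ne_top (μ : PMF ℕ) : total (pmfSeries μ) ≠ ∞ := by simp [total_pmfSeries]

theorem ev_pmfSeries (μ : PMF ℕ) : ev (realSeries (pmfSeries μ)) 1 = 1 := by
  rw [ev_realSeries_one (pmf_ne_top μ), total_pmfSeries, ENNReal.toReal_one]

theorem predSeries_C_add_X_mul (p : ℝ) (N : ℝ⟦X⟧) : predSeries (C p + X * N) = C p + N := by
  ext k
  rcases k with _ | k
  · simp [predSeries, coeff_succ_X_mul]
  · simp [predSeries, coeff_succ_X_mul]

/-- A probability law that solves the fixed point equation yields subcriticality. -/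
theorem subcritical_of_fixed_point {q : unitInterval} (hq : 1 / 2 < (q : ℝ)) (hq' : (q : ℝ) < 1)
    {μ : PMF ℕ} {p : ℝ} (hp : 0 ≤ p) (hqp : q * p < 1) {N K : ℝ⟦X⟧} (hN : ∀ k, 0 ≤ coeff k N)
    (hNc : AbsConv N 1) (hN1 : p + ev N 1 = 1) (hK : ∀ k, 0 ≤ coeff k K)
    (hK1 : K * (1 - C (q : ℝ) * (C p + N)) = 1)
    (h : (C p + X * N) * (1 - C (q : ℝ) * (C p + N)) = C (1 - q : ℝ) * realSeries (pmfSeries μ)) :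
    Subcritical q μ := by
  obtain ⟨B, hB⟩ := exists_mean_bound hq hp hqp hN (coeff_realSeries_nonneg _) hNc
    (absConv_realSeries (pmf_ne_top μ)) hN1 (ev_pmfSeries μ) hq' h
  set A := C p + X * N with hA
  have hAK : A = C (1 - q : ℝ) * (realSeries (pmfSeries μ) * K) := by
    linear_combination K * h - A * hK1
  have hA0 : ∀ k, 0 ≤ coeff k A := by
    intro k
    rcases k with _ | k
    · simp [hA, hp]
    · simp [hA, coeff_succ_X_mul, hN]
  have hAc : AbsConv A 1 := (absConv_C _ _).add ((absConv_X _).mul hNc)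
  have hA1 : ev A 1 = 1 := by
    rw [hA, ev_add (absConv_C _ _) ((absConv_X _).mul hNc), ev_mul (absConv_X _) hNc, ev_C, ev_X,
      one_mul, hN1]
  have hle : ∀ k, coeff k (A * mk 1) ≤ 1 := fun k => by
    rw [coeff_mul_mk_one, ← hA1, ev]
    have := hAc.of_norm
    simp only [one_pow, mul_one] at this ⊢
    exact this.sum_le_tsum _ fun k _ => hA0 k
  have hdom := visitSeries_dominated (μ := μ) hq' hK (by rw [hA, predSeries_C_add_X_mul]; exact hK1)
    hAK hle
  rw [Subcritical, lintegral_rootVisits]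
  refine lt_of_le_of_lt (iSup_le fun n => ?_) (ENNReal.ofReal_lt_top (r := B))
  rw [lintegral_natCast _ (measurable_rootVisitsUpTo n)]
  simp only [law_lt_rootVisitsUpTo hq']
  refine (ENNReal.tsum_le_tsum fun k => ENNReal.ofReal_le_ofReal
    (sub_le_sub_left (hdom n k) 1)).trans ?_
  refine ENNReal.tsum_le_of_sum_range_le fun m => ?_
  rw [← ENNReal.ofReal_sum_of_nonneg fun k _ => sub_nonneg.2 (hle k)]
  exact ENNReal.ofReal_le_ofReal (hB m)

/-- The fixed point is p + yN with N = ((1 - qp)/q)G. The unknown constant c of the tree equation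
has to match p, and the value of that equation at y = 1 ensures this. -/
theorem subcritical_of_exists {q : unitInterval} (hq : 1 / 2 < (q : ℝ)) (hq' : (q : ℝ) < 1)
    {μ : PMF ℕ} (hμ : μ 0 + μ 1 < 1) {p : ℝ} (hp : 0 < p) (hqp : (q : ℝ) * p ≠ 1)
    (hF : F μ (ENNReal.ofReal (q * (1 - q) / (1 - q * p) ^ 2)) 1 ≠ ∞)
    (h : (1 - q * p) / q * (F μ (ENNReal.ofReal (q * (1 - q) / (1 - q * p) ^ 2)) 1).toReal
      + p = 1) : Subcritical q μ := by
  have hq0 : (0 : ℝ) < q := by linarith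
  have hs : (1 - q * p : ℝ) ≠ 0 := sub_ne_zero.2 hqp.symm
  set x : ℝ := q * (1 - q) / (1 - q * p) ^ 2 with hx
  have hx0 : 0 < x := div_pos (mul_pos hq0 (by linarith)) (by positivity)
  rw [F_one_eq_total] at hF h
  have hlt := total_treeSeries_lt_one hμ (ENNReal.ofReal_pos.2 hx0).ne' ENNReal.ofReal_ne_top hF
  obtain ⟨c, K, hc, hK, hK1, hquad⟩ := treeSeries_quadratic μ hx0.le hlt
  rw [← ev_realSeries_one hF] at h
  have hf1 : ev (realSeries (treeSeries (parkedWeight μ (ENNReal.ofReal x)))) 1 < 1 := by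
    rw [ev_realSeries_one hF]
    exact (ENNReal.toReal_lt_toReal hF ENNReal.one_ne_top).2 hlt
  have hGc := absConv_realSeries hF
  have hG0 := coeff_realSeries_nonneg (treeSeries (parkedWeight μ (ENNReal.ofReal x)))
  set G := realSeries (treeSeries (parkedWeight μ (ENNReal.ofReal x)))
  have hf0 : 0 ≤ ev G 1 := ev_nonneg hG0 zero_le_one
  set φ := ev G 1 with hφ
  have hφe : (1 - q * p) * (1 - φ) = 1 - q := by
    field_simp at h
    linear_combination -h
  -- Since φ < 1 and 1 - q > 0, the relation above leaves only the positive sign.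
  have hs0 : (0 : ℝ) < 1 - q * p := by
    by_contra! hle
    have : (1 - q * p) * (1 - φ) ≤ 0 := mul_nonpos_of_nonpos_of_nonneg hle (by linarith)
    linarith
  have hcφ : (c + φ) * (1 - φ) = x := by
    have := congrArg (fun D => ev D 1) hquad
    rw [ev_mul ((absConv_C _ _).add ((absConv_X _).mul hGc)) ((absConv_one _).sub hGc),
      ev_add (absConv_C _ _) ((absConv_X _).mul hGc), ev_mul (absConv_X _) hGc,
      ev_sub (absConv_one _) hGc, ev_C, ev_X, ev_one,
      ev_mul (absConv_C _ _) (absConv_realSeries (pmf_ne_top μ)), ev_C, ev_pmfSeries] at this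
    linarith
  have h1q : (1 - q : ℝ) ≠ 0 := by linarith
  have hcφ2 : (1 - q * p) * (c + φ) = q := by
    have : (1 - q : ℝ) * ((1 - q * p) * (c + φ)) = (1 - q) * q := by
      rw [hx, eq_div_iff (by positivity)] at hcφ
      linear_combination hcφ - (c + φ) * (1 - q * p) * hφe
    exact mul_left_cancel₀ h1q this
  have hcp : p = (1 - q * p) / q * c := by
    field_simp
    linear_combination -hφe - hcφ2
  refine subcritical_of_fixed_point hq hq' hp.le (by linarith) (N := C ((1 - q * p) / q : ℝ) * G)
    (K := C (1 - q * p : ℝ)⁻¹ * K) (fun k => ?_) ((absConv_C _ _).mul hGc) ?_ (fun k => ?_) ?_ ?_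
  · rw [coeff_C_mul]
    exact mul_nonneg (div_nonneg hs0.le hq0.le) (hG0 k)
  · rw [ev_mul (absConv_C _ _) hGc, ev_C]
    linear_combination h
  · rw [coeff_C_mul]
    exact mul_nonneg (inv_nonneg.2 hs0.le) (hK k)
  · have e1 : C (q : ℝ) * C ((1 - q * p) / q : ℝ) = (C (1 - q * p : ℝ) : ℝ⟦X⟧) := by
      rw [← map_mul]
      congr 1
      field_simp
    have e2 : C (1 - q * p : ℝ)⁻¹ * C (1 - q * p : ℝ) = (1 : ℝ⟦X⟧) := by
      rw [← map_mul, inv_mul_cancel₀ hs, map_one]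
    have e3 : (C (1 - q * p : ℝ) : ℝ⟦X⟧) = 1 - C (q : ℝ) * C p := by
      rw [map_sub, map_mul, map_one]
    linear_combination hK1 + K * (1 - G) * e2 - C (1 - q * p : ℝ)⁻¹ * K * G * e1
      - C (1 - q * p : ℝ)⁻¹ * K * e3
  · have e1 : C (q : ℝ) * C ((1 - q * p) / q : ℝ) = (C (1 - q * p : ℝ) : ℝ⟦X⟧) := by
      rw [← map_mul]
      congr 1
      field_simp
    have e2 : (C p : ℝ⟦X⟧) = C ((1 - q * p) / q : ℝ) * C c := by
      rw [← map_mul, ← hcp]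
    have e3 : (C (1 - q * p : ℝ) : ℝ⟦X⟧) = 1 - C (q : ℝ) * C p := by
      rw [map_sub, map_mul, map_one]
    have e4 : C ((1 - q * p) / q : ℝ) * C (1 - q * p : ℝ) * C x = (C (1 - q : ℝ) : ℝ⟦X⟧) := by
      rw [← map_mul, ← map_mul]
      congr 1
      rw [hx]
      field_simp
    have e5 : 1 - C (q : ℝ) * (C p + C ((1 - q * p) / q : ℝ) * G) =
        C (1 - q * p : ℝ) * (1 - G) := by
      linear_combination -e3 - G * e1
    have e6 : C p + X * (C ((1 - q * p) / q : ℝ) * G) =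
        C ((1 - q * p) / q : ℝ) * (C c + X * G) := by
      linear_combination e2
    rw [e5, e6]
    linear_combination C ((1 - q * p) / q : ℝ) * C (1 - q * p : ℝ) * hquad
      + realSeries (pmfSeries μ) * e4

/-! ## The law of `X` -/

/-- The distribution function of `X`. -/
theorem tendsto_cdf (q : unitInterval) (μ : PMF ℕ) (k : ℕ) :
    Filter.Tendsto (fun n => (law q μ).real {ω | rootVisitsUpTo ω n ≤ k}) Filter.atTop
      (nhds ((law q μ).real {ω | rootVisits ω ≤ k})) := by
  have hset : {ω | rootVisits ω ≤ k} = ⋂ n, {ω | rootVisitsUpTo ω n ≤ k} := by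
    ext ω
    simp [rootVisits]
  rw [hset]
  refine (ENNReal.tendsto_toReal (measure_ne_top _ _)).comp ?_
  refine tendsto_measure_iInter_atTop
    (fun n => (measurable_rootVisitsUpTo n measurableSet_Iic).nullMeasurableSet) ?_
    ⟨0, measure_ne_top _ _⟩
  exact fun n m hnm ω hω => (rootVisitsUpTo_mono ω hnm).trans hω

theorem tendsto_coeff_mul {A B : ℕ → ℝ⟦X⟧} {A' B' : ℝ⟦X⟧}
    (hA : ∀ k, Filter.Tendsto (fun n => coeff k (A n)) Filter.atTop (nhds (coeff k A')))
    (hB : ∀ k, Filter.Tendsto (fun n => coeff k (B n)) Filter.atTop (nhds (coeff k B'))) (k : ℕ) :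
    Filter.Tendsto (fun n => coeff k (A n * B n)) Filter.atTop (nhds (coeff k (A' * B'))) := by
  simp only [coeff_mul]
  exact tendsto_finsetSum _ fun p _ => (hA p.1).mul (hB p.2)

/-- In the subcritical case the law of `X` solves the fixed point equation. -/
theorem exists_fixed_point {q : unitInterval} (hq' : (q : ℝ) < 1) {μ : PMF ℕ}
    (h : Subcritical q μ) : ∃ A : ℝ⟦X⟧, (∀ k, 0 ≤ coeff k A) ∧ AbsConv A 1 ∧ ev A 1 = 1 ∧
      A * (1 - C (q : ℝ) * predSeries A) = C (1 - q : ℝ) * realSeries (pmfSeries μ) := by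
  set V := fun n => realSeries (visitSeries q μ n) with hV
  set c : ℕ → ℝ := fun k => (law q μ).real {ω | rootVisits ω ≤ k} with hc
  -- Increments of the distribution function of X, with value 0 before index 0.
  set A : ℝ⟦X⟧ := mk 0 + mk fun k => c k - if k = 0 then 0 else c (k - 1) with hA
  have hAsum : ∀ k, ∑ j ∈ Finset.range (k + 1), coeff j A = c k := by
    intro k
    induction k with
    | zero => simp [hA]
    | succ k ih =>
      rw [Finset.sum_range_succ, ih]
      simp [hA]
  have hcdf : ∀ k, Filter.Tendsto (fun n => ∑ j ∈ Finset.range (k + 1), coeff j (V n))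
      Filter.atTop (nhds (c k)) := by
    intro k
    have := tendsto_cdf q μ k
    simpa only [measureReal_rootVisitsUpTo_le hq', coeff_mul_mk_one] using this
  have hlim : ∀ k, Filter.Tendsto (fun n => coeff k (V n)) Filter.atTop (nhds (coeff k A)) := by
    intro k
    rcases k with _ | k
    · have h0 := hcdf 0
      rw [← hAsum 0] at h0
      simpa only [zero_add, Finset.sum_range_one] using h0
    · have h1 := (hcdf (k + 1)).sub (hcdf k)
      rw [← hAsum (k + 1), ← hAsum k] at h1
      simpa only [Finset.sum_range_succ _ (k + 1), add_sub_cancel_left] using h1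
  have hA0 : ∀ k, 0 ≤ coeff k A := fun k =>
    ge_of_tendsto' (hlim k) fun n => coeff_realSeries_nonneg _ k
  -- Finiteness of the mean is used only through X < ∞ almost surely, which gives A total mass one.
  have hfin : ∀ᵐ ω ∂(law q μ), rootVisits ω < ∞ := by
    refine ae_lt_top ?_ h.ne
    exact Measurable.iSup fun n =>
      (measurable_of_countable fun k : ℕ => (k : ℝ≥0∞)).comp (measurable_rootVisitsUpTo n)
  have hone : Filter.Tendsto c Filter.atTop (nhds 1) := by
    have h1 : law q μ (⋃ k : ℕ, {ω | rootVisits ω ≤ k}) = 1 := by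
      rw [← mem_ae_iff_prob_eq_one₀]
      · filter_upwards [hfin] with ω hω
        obtain ⟨k, hk⟩ := ENNReal.exists_nat_gt hω.ne
        exact Set.mem_iUnion.2 ⟨k, hk.le⟩
      · refine (MeasurableSet.iUnion fun k => measurableSet_le ?_ measurable_const).nullMeasurableSet
        exact Measurable.iSup fun n =>
          (measurable_of_countable fun k : ℕ => (k : ℝ≥0∞)).comp (measurable_rootVisitsUpTo n)
    have h2 := tendsto_measure_iUnion_atTop (μ := law q μ)
      (s := fun k : ℕ => {ω | rootVisits ω ≤ k})
      (fun k l hkl ω hω => by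
        simp only [Set.mem_ofPred_eq] at hω ⊢
        exact hω.trans (Nat.cast_le.2 hkl))
    rw [h1] at h2
    exact (ENNReal.tendsto_toReal ENNReal.one_ne_top).comp h2
  have hsum : HasSum (fun k => coeff k A) 1 := by
    rw [hasSum_iff_tendsto_nat_of_nonneg hA0, ← Filter.tendsto_add_atTop_iff_nat 1]
    simpa only [hAsum] using hone
  refine ⟨A, hA0, ?_, ?_, ?_⟩
  · rw [absConv_iff_summable hA0 zero_le_one]
    simpa using hsum.summable
  · simpa [ev] using hsum.tsum_eq
  · ext k
    have hpred : ∀ k, Filter.Tendsto (fun n => coeff k (1 - C (q : ℝ) * predSeries (V n)))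
        Filter.atTop (nhds (coeff k (1 - C (q : ℝ) * predSeries A))) := by
      intro k
      simp only [map_sub, coeff_C_mul, predSeries, map_add, coeff_mk, coeff_C]
      refine tendsto_const_nhds.sub (((?_ : Filter.Tendsto _ _ _).add (hlim (k + 1))).const_mul _)
      split_ifs
      · exact hlim 0
      · exact tendsto_const_nhds
    -- Each coefficient of a product is a finite sum, so the recursion passes to the limit
    -- coefficient by coefficient.
    have h1 := tendsto_coeff_mul (A := fun n => V (n + 1))
      (fun k => (hlim k).comp (Filter.tendsto_add_atTop_nat 1)) hpred k
    refine tendsto_nhds_unique h1 ?_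
    have h2 : ∀ n, V (n + 1) * (1 - C (q : ℝ) * predSeries (V n)) =
        C (1 - q : ℝ) * realSeries (pmfSeries μ) := by
      intro n
      obtain ⟨K, _, hK1, hK2⟩ := exists_resolvent_visitSeries q μ hq' n
      simp only [hV]
      rw [hK2]
      linear_combination C (1 - q : ℝ) * realSeries (pmfSeries μ) * hK1
    simp only [h2]
    exact tendsto_const_nhds

/-- The law of X provides an explicit solution G of the tree equation with G(1) = q(1 - p)/(1 - qp)
< 1. Minimality bounds the tree series by G, which makes it finite, and the branch-point argument
gives equality. -/
theorem exists_of_subcritical {q : unitInterval} (hq : 1 / 2 < (q : ℝ)) (hq' : (q : ℝ) < 1)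
    {μ : PMF ℕ} (hμ : μ 0 + μ 1 < 1) (h : Subcritical q μ) :
    ∃ p : ℝ, 0 < p ∧ (q : ℝ) * p ≠ 1 ∧
      F μ (ENNReal.ofReal (q * (1 - q) / (1 - q * p) ^ 2)) 1 ≠ ∞ ∧
      (1 - q * p) / q * (F μ (ENNReal.ofReal (q * (1 - q) / (1 - q * p) ^ 2)) 1).toReal
        + p = 1 := by
  have hq0 : (0 : ℝ) < q := by linarith
  have h1q : (0 : ℝ) < 1 - q := by linarith
  obtain ⟨A, hA0, hAc, hA1, hAeq⟩ := exists_fixed_point hq' h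
  obtain ⟨p, N, rfl, hp, hN⟩ : ∃ p N, A = C p + X * N ∧ 0 ≤ p ∧ ∀ k, 0 ≤ coeff k N := by
    refine ⟨coeff 0 A, mk fun k => coeff (k + 1) A, ?_, hA0 0, fun k => ?_⟩
    · rw [add_comm, coeff_zero_eq_constantCoeff]
      exact eq_X_mul_shift_add_const A
    · rw [coeff_mk]
      exact hA0 _
  rw [predSeries_C_add_X_mul] at hAeq
  have hNc : AbsConv N 1 := by
    rw [absConv_iff_summable hA0 zero_le_one, ← summable_nat_add_iff 1] at hAc
    rw [absConv_iff_summable hN zero_le_one]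
    simpa [coeff_succ_X_mul, coeff_C] using hAc
  have hN1 : p + ev N 1 = 1 := by
    rwa [ev_add (absConv_C _ _) ((absConv_X _).mul hNc), ev_mul (absConv_X _) hNc, ev_C, ev_X,
      one_mul] at hA1
  have hM := coeff_realSeries_nonneg (pmfSeries μ)
  have hMc := absConv_realSeries (pmf_ne_top μ)
  have hM2 : ∃ k, 2 ≤ k ∧ 0 < coeff k (realSeries (pmfSeries μ)) := by
    obtain ⟨k, hk, hk'⟩ := exists_two_le hμ
    refine ⟨k, hk, ?_⟩
    rw [coeff_realSeries, pmfSeries, coeff_mk]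
    exact ENNReal.toReal_pos hk' (μ.apply_ne_top k)
  have hp0 := pos_of_fixed_point hq hq' hp hN hM hNc hMc hN1 (ev_pmfSeries μ) hM2 hAeq
  have hev0 : 0 ≤ ev N 1 := ev_nonneg hN zero_le_one
  have hs0 : (0 : ℝ) < 1 - q * p := by nlinarith
  have hs : (1 - q * p : ℝ) ≠ 0 := hs0.ne'
  refine ⟨p, hp0, fun h => hs (by rw [h, sub_self]), ?_⟩
  set x : ℝ := q * (1 - q) / (1 - q * p) ^ 2 with hx
  have hx0 : 0 < x := div_pos (mul_pos hq0 h1q) (by positivity)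
  set c : ℝ := q * p / (1 - q * p) with hc
  have hc0 : 0 < c := div_pos (mul_pos hq0 hp0) hs0
  set G : ℝ⟦X⟧ := C (q / (1 - q * p) : ℝ) * N with hG
  have hG0 : ∀ k, 0 ≤ coeff k G := fun k => by
    rw [hG, coeff_C_mul]
    exact mul_nonneg (div_pos hq0 hs0).le (hN k)
  have hGc : AbsConv G 1 := (absConv_C _ _).mul hNc
  have hG1 : ev G 1 = q * (1 - p) / (1 - q * p) := by
    rw [hG, ev_mul (absConv_C _ _) hNc, ev_C, eq_sub_of_add_eq' hN1]
    ring
  have hG1lt : ev G 1 < 1 := by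
    rw [hG1, div_lt_one hs0]
    linarith
  have hGeq : (C c + X * G) * (1 - G) = C x * realSeries (pmfSeries μ) := by
    have e1 : (C (1 - q * p : ℝ) : ℝ⟦X⟧) = 1 - C (q : ℝ) * C p := by
      rw [map_sub, map_mul, map_one]
    have e2 : (C c : ℝ⟦X⟧) = C (q / (1 - q * p) : ℝ) * C p := by
      rw [← map_mul]
      congr 1
      rw [hc]
      ring
    have e3 : C (q / (1 - q * p) : ℝ) * C (1 - q * p : ℝ)⁻¹ * C (1 - q : ℝ) = (C x : ℝ⟦X⟧) := by
      rw [← map_mul, ← map_mul]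
      congr 1
      rw [hx]
      field_simp
    have e4 : C (1 - q * p : ℝ)⁻¹ * C (1 - q * p : ℝ) = (1 : ℝ⟦X⟧) := by
      rw [← map_mul, inv_mul_cancel₀ hs, map_one]
    have e5 : (C (q / (1 - q * p) : ℝ) : ℝ⟦X⟧) = C (1 - q * p : ℝ)⁻¹ * C (q : ℝ) := by
      rw [← map_mul]
      congr 1
      field_simp
    have e6 : 1 - G = C (1 - q * p : ℝ)⁻¹ * (1 - C (q : ℝ) * (C p + N)) := by
      rw [hG]
      linear_combination -e4 + C (1 - q * p : ℝ)⁻¹ * e1 - N * e5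
    have e7 : C c + X * G = C (q / (1 - q * p) : ℝ) * (C p + X * N) := by
      rw [hG]
      linear_combination e2
    rw [e6, e7]
    linear_combination C (q / (1 - q * p) : ℝ) * C (1 - q * p : ℝ)⁻¹ * hAeq
      + realSeries (pmfSeries μ) * e3
  -- G is lifted to coefficients in [0, ∞], where the minimality of the tree series is formulated.
  obtain ⟨GE, hGE⟩ : ∃ GE : ℝ≥0∞⟦X⟧, ∀ k, coeff k GE = ENNReal.ofReal (coeff k G) :=
    ⟨mk fun k => ENNReal.ofReal (coeff k G), fun k => coeff_mk _ _⟩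
  have hGEreal : realSeries GE = G := by
    ext k
    rw [coeff_realSeries, hGE, ENNReal.toReal_ofReal (hG0 k)]
  have hGEtot : total GE = ENNReal.ofReal (ev G 1) := by
    have := hGc.of_norm
    simp only [one_pow, mul_one] at this
    simp only [total, hGE, ev, one_pow, mul_one]
    exact (ENNReal.ofReal_tsum_of_nonneg hG0 this).symm
  have hGElt : total GE < 1 := by
    rw [hGEtot]
    simpa using hG1lt
  have hKtop := total_geo_ne_top hGElt
  have hKinv := realSeries_geo hGElt
  rw [hGEreal] at hKinv
  have hle : ∀ k, coeff k (treeSeries (parkedWeight μ (ENNReal.ofReal x))) ≤ coeff k GE := by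
    -- Only coefficients of index k + 1 of c + X * G are compared, so the constant c plays no role
    -- in minimality.
    refine coeff_treeSeries_le fun k => le_of_eq ?_
    have hMK : total (pmfSeries μ * geo GE) ≠ ∞ := by
      rw [total_mul]
      exact ENNReal.mul_ne_top (pmf_ne_top μ) hKtop
    rw [← ENNReal.toReal_eq_toReal_iff' (ENNReal.mul_ne_top ENNReal.ofReal_ne_top
      (coeff_ne_top hMK _)) (coeff_ne_top hGElt.ne_top k), ENNReal.toReal_mul,
      ENNReal.toReal_ofReal hx0.le, ← coeff_realSeries, ← coeff_realSeries, hGEreal,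
      realSeries_mul (pmf_ne_top μ) hKtop, ← coeff_C_mul]
    have : C x * (realSeries (pmfSeries μ) * realSeries (geo GE)) = C c + X * G := by
      linear_combination -realSeries (geo GE) * hGeq + (C c + X * G) * hKinv
    rw [this, map_add, coeff_succ_X_mul, coeff_C, if_neg (by omega), zero_add]
  have hFlt : total (treeSeries (parkedWeight μ (ENNReal.ofReal x))) < 1 :=
    (ENNReal.tsum_le_tsum hle).trans_lt hGElt
  obtain ⟨c', K, hc', hK, hK1, hquad⟩ := treeSeries_quadratic μ hx0.le hFlt
  have hFG : realSeries (treeSeries (parkedWeight μ (ENNReal.ofReal x))) = G := by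
    refine eq_of_quadratic (coeff_realSeries_nonneg _) (fun k => ?_) hM hx0 hc0 hc' hGc hM2 hGeq
      hquad ?_
    · rw [← hGEreal, coeff_realSeries, coeff_realSeries]
      exact ENNReal.toReal_mono (coeff_ne_top hGElt.ne_top k) (hle k)
    · have h0 := congrArg (coeff 0) hGeq
      have hG00 : coeff 0 G < 1 := by
        refine lt_of_le_of_lt ?_ hG1lt
        rw [← ev_zero]
        exact ev_le_ev hG0 hGc le_rfl zero_le_one
      rw [coeff_C_mul] at h0
      have h1 : 0 < x * coeff 0 (realSeries (pmfSeries μ)) := by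
        rw [← h0]
        simp only [coeff_zero_eq_constantCoeff, map_mul, map_add, map_sub, map_one] at hG00 ⊢
        simp
        exact mul_pos hc0 (by linarith)
      exact pos_of_mul_pos_right h1 hx0.le
  rw [F_one_eq_total, ← ev_realSeries_one hFlt.ne_top, hFG, hG1]
  refine ⟨hFlt.ne_top, ?_⟩
  field_simp
  ring

end Parking

theorem mainTheorem2 (q : unitInterval) (hq : 1 / 2 < (q : ℝ)) (hq' : (q : ℝ) < 1)
    (μ : PMF ℕ) (hμ : μ 0 + μ 1 < 1) :
    Parking.Subcritical q μ ↔
      ∃ p : ℝ, 0 < p ∧ (q : ℝ) * p ≠ 1 ∧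
        Parking.F μ (ENNReal.ofReal (q * (1 - q) / (1 - q * p) ^ 2)) 1 ≠ ∞ ∧
        (1 - q * p) / q * (Parking.F μ (ENNReal.ofReal (q * (1 - q) / (1 - q * p) ^ 2)) 1).toReal
          + p = 1 :=
  ⟨Parking.exists_of_subcritical hq hq' hμ, fun ⟨_, hp, hqp, hF, h⟩ =>
    Parking.subcritical_of_exists hq hq' hμ hp hqp hF h⟩
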